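/- Let $n\in\mathbb N$ and let $\xi_1,\dots,\xi_n$ be independent (not necessarily identically distributed) real random variables on a probability space with $\mathbb E\,\xi_i=0$, $\mathbb E\,\xi_i^2<\infty$ and $\sum_{i=1}^n\operatorname{Var}(\xi_i)=1$. Put $W=\sum_{i=1}^n\xi_i$, $$\beta_2=\sum_{i=1}^n\mathbb E\big[\xi_i^2\,\mathbf 1(|\xi_i|>1)\big],\qquad \beta_3=\sum_{i=1}^n\mathbb E\big[|\xi_i|^3\,\mathbf 1(|\xi_i|\le 1)\big],$$ and let $\Phi$ be the distribution function of the standard normal law. Then for every $z\in\mathbb R$, $$|\mathbb P(W\le z)-\Phi(z)|\le 2\sum_{i=1}^n\mathbb P\Big(|\xi_i|>\frac{\max(1,|z|)}{4}\Big)+C_2\,(1+|z|)^{-2}(\beta_2+\beta_3),$$ where $$C_2=\begin{cases}15&\text{if }\beta_2+\beta_3\ge 1,\\ 37&\text{if }\beta_2+\beta_3<1\text{ and }|z|\le 2,\\ 25431&\text{if }\beta_2+\beta_3<1\text{ and }|z|>2.\end{cases}$$ -/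

import Mathlib

open MeasureTheory ProbabilityTheory

/-- `β₂ = ∑ i, E[ξ i ^ 2 ; |ξ i| > 1]`. -/
noncomputable def betaTwo {Ω : Type*} [MeasurableSpace Ω] (P : Measure Ω) {n : ℕ}
    (ξ : Fin n → Ω → ℝ) : ℝ :=
  ∑ i, ∫ ω, Set.indicator {ω | 1 < |ξ i ω|} (fun ω => ξ i ω ^ 2) ω ∂P

/-- `β₃ = ∑ i, E[|ξ i| ^ 3 ; |ξ i| ≤ 1]`. -/
noncomputable def betaThree {Ω : Type*} [MeasurableSpace Ω] (P : Measure Ω) {n : ℕ}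
    (ξ : Fin n → Ω → ℝ) : ℝ :=
  ∑ i, ∫ ω, Set.indicator {ω | |ξ i ω| ≤ 1} (fun ω => |ξ i ω| ^ 3) ω ∂P

/-- The explicit constant `C₂`, as a function of `β = β₂ + β₃` and of `z`. -/
noncomputable def constTwo (β z : ℝ) : ℝ :=
  if 1 ≤ β then 15 else if |z| ≤ 2 then 37 else 25431

open Filter Topology

set_option linter.unusedSectionVars false

/-! The proof is Stein's method for the truncated summands `X i = unitTrunc (ξ i)`, carried out for
`z ≥ 0`; negative `z` is reached by reflection. Write `β = β₂ + β₃`, `W` for the sum of the `X i`,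
`V i` for that sum without `X i`, and `f = steinSol z` for the solution of `f' w = w * f w + 1_S w -
Φ z`, where `S` is a left half-line ending at `z`.

Taking expectations at `W`, the error `P(W ∈ S) - Φ z` equals `E f'(W) - E[W f(W)]`. By
independence, `E[X i f(W)]` is `E[X i] E f(V i)` plus the expectation of `X i` times the integral of
`F i t = E f'(V i + t)` over `t` from `0` to `X i`. Since the second moments add up to `1 - β₂`,
everything cancels up to terms in `β₂` and the differences between `F i t` and `E f'(W)`
(`stein_summand`, `abs_measureReal_sub_gaussLower_le`).

These differences are controlled by splitting `f'` into `w * f w` and the indicator. The first is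
increasing, and bounds on its derivative combine with moments of `V i`. The second jumps at `z`, so
it contributes the probability that `V i` lies in a short interval. The latter is at most a multiple
of length plus `β` by a concentration inequality (`concentration`), itself proved by testing `E[V
g(V)]` against a clamped identity `g`.

Decay in `z` comes in three grades. Up to `1.45`, boundedness and the Lipschitz property of `f`
suffice. Up to `2`, a quadratic majorant of `(w f)'` and second moments are needed. Beyond `2`, a
quartic majorant and the fourth moment give order `z⁻²`, both for the Stein terms and for
concentration. If `β` is not small, a one-sided Chebyshev bound on both tails already suffices.
Truncation costs at most `β₂`, and for `z > 2` at most `∑ P(|ξ i| > z/4) + 4 β₂ / z²`, because a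
summand above one is independent of the rest, which must then be large. -/

/-! ### Gaussian tails and the Mills ratio -/

/-- The unnormalised Gaussian tail `∫_w^∞ exp (-t² / 2) dt`. -/
noncomputable def gaussTail (w : ℝ) : ℝ :=
  √(2 * Real.pi) / 2 - ∫ t in (0 : ℝ)..w, Real.exp (-t ^ 2 / 2)

lemma continuous_exp_neg_sq_half : Continuous fun t : ℝ => Real.exp (-t ^ 2 / 2) := by fun_prop

lemma hasDerivAt_exp_neg_sq_half (w : ℝ) :
    HasDerivAt (fun t : ℝ => Real.exp (-t ^ 2 / 2)) (-w * Real.exp (-w ^ 2 / 2)) w := by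
  have h : HasDerivAt (fun t : ℝ => -t ^ 2 / 2) (-w) w :=
    ((hasDerivAt_pow 2 w).neg.div_const 2).congr_deriv (by norm_num; ring)
  exact h.exp.congr_deriv (mul_comm _ _)

lemma hasDerivAt_exp_sq_half (w : ℝ) :
    HasDerivAt (fun t : ℝ => Real.exp (t ^ 2 / 2)) (w * Real.exp (w ^ 2 / 2)) w := by
  have h : HasDerivAt (fun t : ℝ => t ^ 2 / 2) w w :=
    ((hasDerivAt_pow 2 w).div_const 2).congr_deriv (by norm_num)
  exact h.exp.congr_deriv (mul_comm _ _)

lemma exp_mul_exp_neg_sq_half (w : ℝ) :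
    Real.exp (w ^ 2 / 2) * Real.exp (-w ^ 2 / 2) = 1 := by
  rw [← Real.exp_add]; ring_nf; simp

lemma hasDerivAt_gaussTail (w : ℝ) :
    HasDerivAt gaussTail (-Real.exp (-w ^ 2 / 2)) w := by
  have h := intervalIntegral.integral_hasDerivAt_right
    (continuous_exp_neg_sq_half.intervalIntegrable 0 w)
    (continuous_exp_neg_sq_half.stronglyMeasurableAtFilter _ _)
    continuous_exp_neg_sq_half.continuousAt
  exact h.const_sub (√(2 * Real.pi) / 2)

lemma gaussTail_neg (w : ℝ) : gaussTail (-w) = √(2 * Real.pi) - gaussTail w := by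
  have h : ∫ t in (0 : ℝ)..(-w), Real.exp (-t ^ 2 / 2)
      = - ∫ t in (0 : ℝ)..w, Real.exp (-t ^ 2 / 2) := by
    rw [intervalIntegral.integral_symm]
    have := intervalIntegral.integral_comp_neg (a := 0) (b := w)
      (fun t : ℝ => Real.exp (-t ^ 2 / 2))
    simp only [neg_sq, neg_zero] at this
    rw [← this]
  simp only [gaussTail, h]
  ring

lemma integrable_exp_neg_sq_half : Integrable fun t : ℝ => Real.exp (-t ^ 2 / 2) := by
  convert integrable_exp_neg_mul_sq (b := 1 / 2) (by norm_num) using 3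
  ring

lemma integral_Ioi_exp_neg_sq_half :
    ∫ t in Set.Ioi (0 : ℝ), Real.exp (-t ^ 2 / 2) = √(2 * Real.pi) / 2 := by
  have h := integral_gaussian_Ioi (1 / 2)
  rw [show Real.pi / (1 / 2) = 2 * Real.pi by ring] at h
  rw [← h]
  congr 1 with t
  ring_nf

lemma tendsto_gaussTail : Tendsto gaussTail atTop (𝓝 0) := by
  have h := intervalIntegral_tendsto_integral_Ioi (0 : ℝ)
    integrable_exp_neg_sq_half.integrableOn tendsto_id
  rw [integral_Ioi_exp_neg_sq_half] at h
  have h2 := h.const_sub (√(2 * Real.pi) / 2)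
  rw [sub_self] at h2
  exact h2

lemma tendsto_exp_neg_sq_half : Tendsto (fun t : ℝ => Real.exp (-t ^ 2 / 2)) atTop (𝓝 0) := by
  refine Real.tendsto_exp_atBot.comp ?_
  have h : Tendsto (fun t : ℝ => t ^ 2 / 2) atTop atTop :=
    (tendsto_pow_atTop (by norm_num)).atTop_div_const (by norm_num)
  convert tendsto_neg_atTop_atBot.comp h using 1
  ext t; simp; ring

lemma strictAnti_gaussTail : StrictAnti gaussTail :=
  strictAnti_of_hasDerivAt_neg hasDerivAt_gaussTail fun w => by simpa using Real.exp_pos _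

lemma gaussTail_pos (w : ℝ) : 0 < gaussTail w :=
  (strictAnti_gaussTail.antitone.le_of_tendsto tendsto_gaussTail (w + 1)).trans_lt
    (strictAnti_gaussTail (by linarith))

/-- For `w > 0` the difference `D` of the tail and `exp (-t² / 2) / t` has derivative `exp (-t² / 2)
/ t²`, so it increases to its limit `0` and is nonpositive. -/
lemma mul_gaussTail_le (w : ℝ) : w * gaussTail w ≤ Real.exp (-w ^ 2 / 2) := by
  rcases le_or_gt w 0 with hw | hw
  · exact (mul_nonpos_of_nonpos_of_nonneg hw (gaussTail_pos w).le).trans (Real.exp_pos _).le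
  set D : ℝ → ℝ := fun t => gaussTail t - Real.exp (-t ^ 2 / 2) * t⁻¹ with hD
  have hder : ∀ t ∈ Set.Ioi (0 : ℝ), HasDerivAt D (Real.exp (-t ^ 2 / 2) / t ^ 2) t := by
    intro t ht
    have ht' : t ≠ 0 := ne_of_gt ht
    refine ((hasDerivAt_gaussTail t).sub
      ((hasDerivAt_exp_neg_sq_half t).mul (hasDerivAt_inv ht'))).congr_deriv ?_
    field_simp
    ring
  have hmono : MonotoneOn D (Set.Ioi 0) := by
    refine monotoneOn_of_deriv_nonneg (convex_Ioi 0)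
      (fun t ht => (hder t ht).continuousAt.continuousWithinAt)
      (fun t ht => (hder t (by simpa using ht)).differentiableAt.differentiableWithinAt) ?_
    intro t ht
    rw [(hder t (by simpa using ht)).deriv]
    positivity
  have hlim : Tendsto D atTop (𝓝 0) := by
    have := tendsto_gaussTail.sub (tendsto_exp_neg_sq_half.mul tendsto_inv_atTop_zero)
    simpa [hD] using this
  have h0 : D w ≤ 0 := by
    refine ge_of_tendsto hlim ?_
    filter_upwards [eventually_ge_atTop w] with t ht
    exact hmono hw (lt_of_lt_of_le hw ht) ht
  have h1 : gaussTail w ≤ Real.exp (-w ^ 2 / 2) * w⁻¹ := by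
    simpa [hD] using h0
  calc w * gaussTail w ≤ w * (Real.exp (-w ^ 2 / 2) * w⁻¹) := by gcongr
    _ = _ := by field_simp

/-- The companion lower bound: the difference `D` now decreases to `0` on the whole line. It is what
makes `w * steinSol z w` increasing. -/
lemma le_one_add_sq_mul_gaussTail (w : ℝ) :
    w * Real.exp (-w ^ 2 / 2) ≤ (1 + w ^ 2) * gaussTail w := by
  set D : ℝ → ℝ := fun t => gaussTail t - Real.exp (-t ^ 2 / 2) * (t / (1 + t ^ 2)) with hD
  have hder : ∀ t, HasDerivAt D (-(2 * Real.exp (-t ^ 2 / 2) / (1 + t ^ 2) ^ 2)) t := by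
    intro t
    have h2 : HasDerivAt (fun t : ℝ => 1 + t ^ 2) (2 * t) t := by
      simpa using (hasDerivAt_pow 2 t).const_add 1
    have ht : (1 + t ^ 2 : ℝ) ≠ 0 := by positivity
    refine ((hasDerivAt_gaussTail t).sub
      ((hasDerivAt_exp_neg_sq_half t).mul ((hasDerivAt_id t).div h2 ht))).congr_deriv ?_
    simp only [id, Pi.div_apply]
    field_simp
    ring
  have hanti : Antitone D := by
    refine antitone_of_deriv_nonpos (fun t => (hder t).differentiableAt) fun t => ?_
    rw [(hder t).deriv]
    exact neg_nonpos.2 (by positivity)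
  have hlim : Tendsto D atTop (𝓝 0) := by
    have hz : Tendsto (fun t : ℝ => Real.exp (-t ^ 2 / 2) * (t / (1 + t ^ 2))) atTop (𝓝 0) := by
      refine squeeze_zero_norm (fun t => ?_) tendsto_exp_neg_sq_half
      rw [norm_mul, Real.norm_eq_abs, Real.abs_exp, Real.norm_eq_abs]
      refine mul_le_of_le_one_right (Real.exp_pos _).le ?_
      rw [abs_div, abs_of_pos (by positivity : (0 : ℝ) < 1 + t ^ 2), div_le_one (by positivity)]
      nlinarith [sq_nonneg (|t| - 1), sq_abs t, abs_nonneg t]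
    simpa [hD] using tendsto_gaussTail.sub hz
  have h0 : 0 ≤ D w := hanti.le_of_tendsto hlim w
  have h1 : Real.exp (-w ^ 2 / 2) * (w / (1 + w ^ 2)) ≤ gaussTail w := by
    simpa [hD] using h0
  have h2 : (0 : ℝ) < 1 + w ^ 2 := by positivity
  calc w * Real.exp (-w ^ 2 / 2)
      = (1 + w ^ 2) * (Real.exp (-w ^ 2 / 2) * (w / (1 + w ^ 2))) := by field_simp
    _ ≤ _ := by gcongr

lemma gaussianReal_real_Iic (z : ℝ) :
    (gaussianReal 0 1).real (Set.Iic z) = gaussTail (-z) / √(2 * Real.pi) := by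
  have hpi : (0 : ℝ) < √(2 * Real.pi) := by positivity
  have hpdf : ∀ x, gaussianPDFReal 0 1 x = (√(2 * Real.pi))⁻¹ * Real.exp (-x ^ 2 / 2) := by
    intro x
    simp [gaussianPDFReal]
  have h0 : ∫ x in Set.Iic (0 : ℝ), Real.exp (-x ^ 2 / 2) = √(2 * Real.pi) / 2 := by
    have := integral_comp_neg_Iic (0 : ℝ) (fun t : ℝ => Real.exp (-t ^ 2 / 2))
    simp only [neg_sq, neg_zero] at this
    rw [this, integral_Ioi_exp_neg_sq_half]
  have h1 : ∫ x in Set.Iic z, Real.exp (-x ^ 2 / 2) = gaussTail (-z) := by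
    have := intervalIntegral.integral_Iic_sub_Iic (a := 0) (b := z)
      integrable_exp_neg_sq_half.integrableOn integrable_exp_neg_sq_half.integrableOn
    rw [gaussTail_neg, gaussTail, ← this, h0]
    ring
  rw [measureReal_def, gaussianReal_apply_eq_integral 0 one_ne_zero, ENNReal.toReal_ofReal]
  · simp_rw [hpdf]
    rw [integral_const_mul, h1]
    field_simp
  · exact integral_nonneg fun x => gaussianPDFReal_nonneg 0 1 x

/-- The Mills ratio of the standard normal law. -/
noncomputable def mills (w : ℝ) : ℝ := Real.exp (w ^ 2 / 2) * gaussTail w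

lemma mills_pos (w : ℝ) : 0 < mills w := mul_pos (Real.exp_pos _) (gaussTail_pos w)

lemma hasDerivAt_mills (w : ℝ) : HasDerivAt mills (w * mills w - 1) w := by
  refine ((hasDerivAt_exp_sq_half w).mul (hasDerivAt_gaussTail w)).congr_deriv ?_
  have := exp_mul_exp_neg_sq_half w
  simp only [mills]
  linarith

lemma continuous_mills : Continuous mills :=
  continuous_iff_continuousAt.2 fun w => (hasDerivAt_mills w).continuousAt

lemma mul_mills_le (w : ℝ) : w * mills w ≤ 1 := by
  have := mul_le_mul_of_nonneg_left (mul_gaussTail_le w) (Real.exp_pos (w ^ 2 / 2)).le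
  rw [exp_mul_exp_neg_sq_half] at this
  simp only [mills]
  linarith

lemma le_one_add_sq_mul_mills (w : ℝ) : w ≤ (1 + w ^ 2) * mills w := by
  have := mul_le_mul_of_nonneg_left (le_one_add_sq_mul_gaussTail w) (Real.exp_pos (w ^ 2 / 2)).le
  have h := exp_mul_exp_neg_sq_half w
  have h2 : Real.exp (w ^ 2 / 2) * (w * Real.exp (-w ^ 2 / 2)) = w := by linear_combination w * h
  simp only [mills]
  linarith

lemma antitone_mills : Antitone mills :=
  antitone_of_deriv_nonpos (fun w => (hasDerivAt_mills w).differentiableAt) fun w => by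
    rw [(hasDerivAt_mills w).deriv]; linarith [mul_mills_le w]

lemma mills_zero : mills 0 = √(2 * Real.pi) / 2 := by simp [mills, gaussTail]

lemma mills_neg (w : ℝ) : mills (-w) = √(2 * Real.pi) * Real.exp (w ^ 2 / 2) - mills w := by
  simp only [mills, gaussTail_neg, neg_sq]; ring

lemma sqrt_two_pi_lt : √(2 * Real.pi) < 2.5067 := by
  rw [Real.sqrt_lt' (by norm_num)]
  nlinarith [Real.pi_lt_d4]

lemma lt_sqrt_two_pi : 2 < √(2 * Real.pi) := by
  rw [Real.lt_sqrt (by norm_num)]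
  nlinarith [Real.pi_gt_three]

/-! ### The Stein equation for half-lines -/

/-- `1 - Φ(z)`. -/
noncomputable def gaussUpper (z : ℝ) : ℝ := gaussTail z / √(2 * Real.pi)

/-- `Φ(z)`. -/
noncomputable def gaussLower (z : ℝ) : ℝ := gaussTail (-z) / √(2 * Real.pi)

lemma sqrt_two_pi_pos : 0 < √(2 * Real.pi) := by positivity

lemma gaussUpper_pos (z : ℝ) : 0 < gaussUpper z := div_pos (gaussTail_pos _) sqrt_two_pi_pos

lemma gaussLower_pos (z : ℝ) : 0 < gaussLower z := div_pos (gaussTail_pos _) sqrt_two_pi_pos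

lemma gaussLower_add_gaussUpper (z : ℝ) : gaussLower z + gaussUpper z = 1 := by
  have := sqrt_two_pi_pos.ne'
  simp only [gaussLower, gaussUpper, gaussTail_neg]
  field_simp
  ring

lemma mul_gaussUpper_le (z : ℝ) :
    z * gaussUpper z ≤ Real.exp (-z ^ 2 / 2) / √(2 * Real.pi) := by
  rw [gaussUpper, mul_div_assoc']
  have := mul_gaussTail_le z
  gcongr

/-- The bounded solution of the Stein equation for the half-line ending at `z`. -/
noncomputable def steinSol (z w : ℝ) : ℝ :=
  if w ≤ z then gaussUpper z * mills (-w) else gaussLower z * mills w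

lemma steinSol_of_le {z w : ℝ} (h : w ≤ z) : steinSol z w = gaussUpper z * mills (-w) := if_pos h

lemma gaussUpper_mul_mills_neg (z : ℝ) :
    gaussUpper z * mills (-z) = gaussLower z * mills z := by
  simp only [gaussUpper, gaussLower, mills, neg_sq]; ring

lemma steinSol_of_ge {z w : ℝ} (h : z ≤ w) : steinSol z w = gaussLower z * mills w := by
  rcases h.eq_or_lt with rfl | h
  · rw [steinSol_of_le le_rfl, gaussUpper_mul_mills_neg]
  · exact if_neg (not_le.2 h)

lemma continuous_steinSol (z : ℝ) : Continuous (steinSol z) := by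
  refine Continuous.if_le ?_ ?_ continuous_id continuous_const ?_
  · exact continuous_const.mul (continuous_mills.comp continuous_neg)
  · exact continuous_const.mul continuous_mills
  · rintro w rfl
    exact gaussUpper_mul_mills_neg w

lemma steinSol_pos (z w : ℝ) : 0 < steinSol z w := by
  unfold steinSol
  split_ifs
  · exact mul_pos (gaussUpper_pos z) (mills_pos _)
  · exact mul_pos (gaussLower_pos z) (mills_pos _)

/-- The right-hand side of the Stein equation solved for the derivative. -/
noncomputable def steinDer (S : Set ℝ) (z w : ℝ) : ℝ :=
  w * steinSol z w + S.indicator 1 w - gaussLower z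

lemma steinDer_of_mem {S : Set ℝ} {w : ℝ} (z : ℝ) (h : w ∈ S) :
    steinDer S z w = w * steinSol z w + gaussUpper z := by
  rw [steinDer, Set.indicator_of_mem h, Pi.one_apply]
  linarith [gaussLower_add_gaussUpper z]

lemma steinDer_of_notMem {S : Set ℝ} {w : ℝ} (z : ℝ) (h : w ∉ S) :
    steinDer S z w = w * steinSol z w - gaussLower z := by
  rw [steinDer, Set.indicator_of_notMem h, add_zero]

/-- `S` is the open or the closed left half-line ending at `z`. -/
def IsLeftRay (S : Set ℝ) (z : ℝ) : Prop := S = Set.Iio z ∨ S = Set.Iic z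

lemma IsLeftRay.measurableSet {S : Set ℝ} {z : ℝ} (hS : IsLeftRay S z) : MeasurableSet S := by
  rcases hS with rfl | rfl
  · exact measurableSet_Iio
  · exact measurableSet_Iic

lemma IsLeftRay.mem_of_lt {S : Set ℝ} {z w : ℝ} (hS : IsLeftRay S z) (h : w < z) : w ∈ S := by
  rcases hS with rfl | rfl
  · exact h
  · exact h.le

lemma IsLeftRay.le_of_mem {S : Set ℝ} {z w : ℝ} (hS : IsLeftRay S z) (h : w ∈ S) : w ≤ z := by
  rcases hS with rfl | rfl
  · exact le_of_lt h
  · exact h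

lemma IsLeftRay.le_of_notMem {S : Set ℝ} {z w : ℝ} (hS : IsLeftRay S z) (h : w ∉ S) : z ≤ w :=
  not_lt.1 fun h' => h (hS.mem_of_lt h')

lemma hasDerivAt_mills_neg (w : ℝ) :
    HasDerivAt (fun t => mills (-t)) (1 + w * mills (-w)) w :=
  ((hasDerivAt_mills (-w)).comp w (hasDerivAt_neg w)).congr_deriv (by ring)

lemma hasDerivAt_steinSol {S : Set ℝ} {z : ℝ} (hS : IsLeftRay S z) {w : ℝ} (hw : w ≠ z) :
    HasDerivAt (steinSol z) (steinDer S z w) w := by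
  rcases hw.lt_or_gt with h | h
  · rw [steinDer_of_mem z (hS.mem_of_lt h), steinSol_of_le h.le]
    refine (((hasDerivAt_mills_neg w).const_mul (gaussUpper z)).congr_deriv
      (by ring)).congr_of_eventuallyEq ?_
    filter_upwards [Iio_mem_nhds h] with t ht
    exact steinSol_of_le (le_of_lt ht)
  · rw [steinDer_of_notMem z (fun h' => absurd (hS.le_of_mem h') (not_le.2 h)),
      steinSol_of_ge h.le]
    refine (((hasDerivAt_mills w).const_mul (gaussLower z)).congr_deriv
      (by ring)).congr_of_eventuallyEq ?_
    filter_upwards [Ioi_mem_nhds h] with t ht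
    exact steinSol_of_ge (le_of_lt ht)

/-- The Stein solution has a corner at `z`, so monotonicity is obtained on the two closed half-lines
and glued by continuity. -/
lemma monotone_of_hasDerivAt_of_ne {F F' : ℝ → ℝ} {z : ℝ} (hF : Continuous F)
    (hd : ∀ w, w ≠ z → HasDerivAt F (F' w) w) (hn : ∀ w, w ≠ z → 0 ≤ F' w) : Monotone F := by
  refine MonotoneOn.Iic_union_Ici (a := z) ?_ ?_
  · refine monotoneOn_of_deriv_nonneg (convex_Iic z) hF.continuousOn ?_ ?_ <;>
      simp only [interior_Iic, Set.mem_Iio] <;> intro w hw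
    · exact (hd w hw.ne).differentiableAt.differentiableWithinAt
    · rw [(hd w hw.ne).deriv]; exact hn w hw.ne
  · refine monotoneOn_of_deriv_nonneg (convex_Ici z) hF.continuousOn ?_ ?_ <;>
      simp only [interior_Ici, Set.mem_Ioi] <;> intro w hw
    · exact (hd w hw.ne').differentiableAt.differentiableWithinAt
    · rw [(hd w hw.ne').deriv]; exact hn w hw.ne'

/-- The derivative of `w ↦ w * steinSol z w` away from `z`. -/
noncomputable def steinMulDer (z w : ℝ) : ℝ :=
  if w ≤ z then gaussUpper z * ((1 + w ^ 2) * mills (-w) + w)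
  else gaussLower z * ((1 + w ^ 2) * mills w - w)

lemma hasDerivAt_mul_steinSol {z w : ℝ} (hw : w ≠ z) :
    HasDerivAt (fun t => t * steinSol z t) (steinMulDer z w) w := by
  have h := (hasDerivAt_id w).mul (hasDerivAt_steinSol (S := Set.Iic z) (Or.inr rfl) hw)
  refine h.congr_deriv ?_
  rcases hw.lt_or_gt with h | h
  · rw [steinDer_of_mem z (show w ∈ Set.Iic z from h.le), steinSol_of_le h.le, steinMulDer, if_pos h.le]
    simp only [id]; ring
  · rw [steinDer_of_notMem z (show w ∉ Set.Iic z from not_le.2 h), steinSol_of_ge h.le, steinMulDer, if_neg (not_le.2 h)]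
    simp only [id]; ring

lemma steinMulDer_nonneg (z w : ℝ) : 0 ≤ steinMulDer z w := by
  unfold steinMulDer
  split_ifs
  · refine mul_nonneg (gaussUpper_pos z).le ?_
    have := le_one_add_sq_mul_mills (-w)
    rw [neg_sq] at this
    linarith
  · refine mul_nonneg (gaussLower_pos z).le ?_
    linarith [le_one_add_sq_mul_mills w]

lemma continuous_mul_steinSol (z : ℝ) : Continuous fun w => w * steinSol z w :=
  continuous_id.mul (continuous_steinSol z)

lemma monotone_mul_steinSol (z : ℝ) : Monotone fun w => w * steinSol z w :=
  monotone_of_hasDerivAt_of_ne (continuous_mul_steinSol z)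
    (fun _ hw => hasDerivAt_mul_steinSol hw) fun w _ => steinMulDer_nonneg z w

lemma mul_steinSol_le {z : ℝ} (w : ℝ) : w * steinSol z w ≤ gaussLower z := by
  have key : ∀ v, z ≤ v → v * steinSol z v ≤ gaussLower z := fun v hv => by
    rw [steinSol_of_ge hv]
    nlinarith [mul_mills_le v, gaussLower_pos z]
  rcases le_total z w with h | h
  · exact key w h
  · exact (monotone_mul_steinSol z h).trans (key z le_rfl)

lemma neg_gaussUpper_le_mul_steinSol {z w : ℝ} (hw : w ≤ z) :
    -gaussUpper z ≤ w * steinSol z w := by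
  rw [steinSol_of_le hw]
  nlinarith [mul_mills_le (-w), gaussUpper_pos z]

/-- On `S` the derivative is `w * f w + (1 - Φ z)` with `w * f w` between `-(1 - Φ z)` and `Φ z`;
off `S` it is `w * f w - Φ z`, where `w * f w` is nonnegative because `0 ≤ z ≤ w`. -/
lemma abs_steinDer_le_one {S : Set ℝ} {z : ℝ} (hS : IsLeftRay S z) (hz : 0 ≤ z) (w : ℝ) :
    |steinDer S z w| ≤ 1 := by
  have h1 := gaussLower_add_gaussUpper z
  have h2 := mul_steinSol_le (z := z) w
  have h3 := gaussLower_pos z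
  have h4 := gaussUpper_pos z
  rw [abs_le]
  by_cases h : w ∈ S
  · rw [steinDer_of_mem z h]
    have := neg_gaussUpper_le_mul_steinSol (hS.le_of_mem h)
    constructor <;> linarith
  · rw [steinDer_of_notMem z h]
    have := mul_nonneg (hz.trans (hS.le_of_notMem h)) (steinSol_pos z w).le
    constructor <;> linarith

lemma steinSol_le_self (z w : ℝ) : steinSol z w ≤ steinSol z z := by
  rcases le_total w z with h | h
  · rw [steinSol_of_le h, steinSol_of_le le_rfl]
    exact mul_le_mul_of_nonneg_left (antitone_mills (by linarith)) (gaussUpper_pos z).le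
  · rw [steinSol_of_ge h, steinSol_of_ge le_rfl]
    exact mul_le_mul_of_nonneg_left (antitone_mills h) (gaussLower_pos z).le

lemma gaussLower_le_one (z : ℝ) : gaussLower z ≤ 1 := by
  linarith [gaussLower_add_gaussUpper z, gaussUpper_pos z]

lemma steinSol_le_mills {z : ℝ} (w : ℝ) : steinSol z w ≤ mills z := by
  refine (steinSol_le_self z w).trans ?_
  rw [steinSol_of_ge le_rfl]
  exact mul_le_of_le_one_left (mills_pos z).le (gaussLower_le_one z)

/-- The constant `1.26` rounds up `√(2π) / 2`, the Mills ratio at the origin. -/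
lemma steinSol_le_of_nonneg {z : ℝ} (hz : 0 ≤ z) (w : ℝ) : steinSol z w ≤ 1.26 := by
  refine (steinSol_le_mills w).trans ((antitone_mills hz).trans ?_)
  rw [mills_zero]
  linarith [sqrt_two_pi_lt]

lemma mills_le_inv {z : ℝ} (hz : 0 < z) : mills z ≤ 1 / z := by
  rw [le_div_iff₀ hz]; linarith [mul_mills_le z]

lemma steinSol_le_inv {z : ℝ} (hz : 0 < z) (w : ℝ) : steinSol z w ≤ 1 / z :=
  (steinSol_le_mills w).trans (mills_le_inv hz)

lemma abs_steinSol_sub_le {z : ℝ} (hz : 0 ≤ z) (u v : ℝ) :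
    |steinSol z u - steinSol z v| ≤ |u - v| := by
  have hS : IsLeftRay (Set.Iic z) z := Or.inr rfl
  have hb := fun w => abs_le.1 (abs_steinDer_le_one hS hz w)
  have h1 : Monotone fun w => w - steinSol z w :=
    monotone_of_hasDerivAt_of_ne (continuous_id.sub (continuous_steinSol z))
      (fun w hw => (hasDerivAt_id w).sub (hasDerivAt_steinSol hS hw))
      fun w _ => by linarith [(hb w).2]
  have h2 : Monotone fun w => w + steinSol z w :=
    monotone_of_hasDerivAt_of_ne (continuous_id.add (continuous_steinSol z))
      (fun w hw => (hasDerivAt_id w).add (hasDerivAt_steinSol hS hw))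
      fun w _ => by linarith [(hb w).1]
  rcases le_total u v with h | h
  · have e1 := h1 h
    have e2 := h2 h
    simp only at e1 e2
    rw [abs_of_nonpos (by linarith : u - v ≤ 0), abs_le]
    constructor <;> linarith
  · have e1 := h1 h
    have e2 := h2 h
    simp only at e1 e2
    rw [abs_of_nonneg (by linarith : 0 ≤ u - v), abs_le]
    constructor <;> linarith

lemma measurable_steinDer {S : Set ℝ} {z : ℝ} (hS : IsLeftRay S z) :
    Measurable (steinDer S z) :=
  (((continuous_mul_steinSol z).measurable).add
    (measurable_one.indicator hS.measurableSet)).sub_const _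

lemma intervalIntegrable_steinDer {S : Set ℝ} {z : ℝ} (hS : IsLeftRay S z) (hz : 0 ≤ z)
    (v a b : ℝ) : IntervalIntegrable (fun t => steinDer S z (v + t)) volume a b := by
  refine (intervalIntegrable_const (c := (1 : ℝ))).mono_fun ?_ ?_
  · exact ((measurable_steinDer hS).comp (measurable_const_add v)).aestronglyMeasurable
  · exact ae_of_all _ fun t => by
      simpa using abs_steinDer_le_one hS hz (v + t)

lemma integral_steinDer {S : Set ℝ} {z : ℝ} (hS : IsLeftRay S z) (hz : 0 ≤ z) (v x : ℝ) :
    ∫ t in (0 : ℝ)..x, steinDer S z (v + t) = steinSol z (v + x) - steinSol z v := by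
  have h := integral_eq_of_hasDerivAt_off_countable (fun t => steinSol z (v + t))
    (fun t => steinDer S z (v + t)) (a := 0) (b := x) (s := {z - v}) (Set.countable_singleton _)
    ((continuous_steinSol z).comp (continuous_const_add v)).continuousOn ?_
    (intervalIntegrable_steinDer hS hz v 0 x)
  · simpa using h
  · intro t ht
    have hne : v + t ≠ z := fun h => ht.2 (by simp [← h])
    simpa using (hasDerivAt_steinSol hS hne).comp_const_add v t

/-! ### Bounds on the Stein solution for positive `z` -/

lemma exp_le_chord {a l : ℝ} (h0 : 0 ≤ l) (h1 : l ≤ 1) :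
    Real.exp (-(1 - l) * a) ≤ (1 - l) * Real.exp (-a) + l := by
  have h := convexOn_exp.2 (Set.mem_univ (-a)) (Set.mem_univ 0) (sub_nonneg.2 h1) h0 (by ring)
  simp only [smul_eq_mul, Real.exp_zero, mul_one, mul_zero, add_zero] at h
  rwa [show -(1 - l) * a = (1 - l) * -a by ring]

/-- On `0 ≤ w ≤ z` the solution and its relatives are controlled by this exponential. -/
lemma gaussUpper_mul_mills_neg_le {z : ℝ} (hz : 0 < z) (w : ℝ) :
    gaussUpper z * (√(2 * Real.pi) * Real.exp (w ^ 2 / 2))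
      ≤ Real.exp ((w ^ 2 - z ^ 2) / 2) / z := by
  have h := mul_gaussUpper_le z
  have hs := sqrt_two_pi_pos
  rw [le_div_iff₀ hs] at h
  rw [le_div_iff₀ hz, show (w ^ 2 - z ^ 2) / 2 = w ^ 2 / 2 + -z ^ 2 / 2 by ring, Real.exp_add]
  nlinarith [Real.exp_pos (w ^ 2 / 2)]

lemma gaussUpper_le {z : ℝ} (hz : 0 < z) : gaussUpper z ≤ Real.exp (-z ^ 2 / 2) / (2 * z) := by
  have h := gaussUpper_mul_mills_neg_le hz 0
  have h2 := lt_sqrt_two_pi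
  have hq := gaussUpper_pos z
  simp only [ne_eq, OfNat.ofNat_ne_zero, not_false_eq_true, zero_pow, zero_div, Real.exp_zero,
    mul_one, zero_sub] at h
  rw [le_div_iff₀ hz] at h
  rw [le_div_iff₀ (by positivity)]
  nlinarith [mul_pos hq hz]

lemma gaussUpper_mul_mills_le {z u : ℝ} (hz : 0 < z) (hu : 0 ≤ u) :
    gaussUpper z * mills u ≤ Real.exp (-z ^ 2 / 2) / z := by
  have h := gaussUpper_mul_mills_neg_le hz 0
  have hq := gaussUpper_pos z
  simp only [ne_eq, OfNat.ofNat_ne_zero, not_false_eq_true, zero_pow, zero_div, Real.exp_zero,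
    mul_one, zero_sub] at h
  refine le_trans (mul_le_mul_of_nonneg_left ?_ hq.le) h
  refine (antitone_mills hu).trans ?_
  rw [mills_zero]
  linarith [sqrt_two_pi_pos]

/-- The three ranges behave differently: exponentially small on the left, growing like `exp ((w² -
z²) / 2)` up to `z`, and of size `1 / z` beyond. In the middle range `mills (-w)` is rewritten by
reflection, and the lower Mills bound absorbs the summand `w`. -/
lemma steinMulDer_le {z w : ℝ} (hz : 0 < z) :
    (w ≤ 0 → steinMulDer z w ≤ Real.exp (-z ^ 2 / 2) / z) ∧
    (0 ≤ w → w ≤ z → steinMulDer z w ≤ (1 + w ^ 2) * Real.exp ((w ^ 2 - z ^ 2) / 2) / z) ∧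
    (z < w → steinMulDer z w ≤ 1 / z) := by
  refine ⟨fun hw => ?_, fun hw hwz => ?_, fun hw => ?_⟩
  · rw [steinMulDer, if_pos (hw.trans hz.le)]
    refine le_trans (mul_le_mul_of_nonneg_left ?_ (gaussUpper_pos z).le)
      (gaussUpper_mul_mills_le hz (neg_nonneg.2 hw))
    nlinarith [mul_mills_le (-w), mills_pos (-w)]
  · rw [steinMulDer, if_pos hwz]
    have h1 := gaussUpper_mul_mills_neg_le hz w
    have h2 := le_one_add_sq_mul_mills w
    calc gaussUpper z * ((1 + w ^ 2) * mills (-w) + w)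
        ≤ gaussUpper z * ((1 + w ^ 2) * (√(2 * Real.pi) * Real.exp (w ^ 2 / 2))) := by
          refine mul_le_mul_of_nonneg_left ?_ (gaussUpper_pos z).le
          rw [mills_neg]
          linarith
      _ = (1 + w ^ 2) * (gaussUpper z * (√(2 * Real.pi) * Real.exp (w ^ 2 / 2))) := by ring
      _ ≤ (1 + w ^ 2) * (Real.exp ((w ^ 2 - z ^ 2) / 2) / z) := by gcongr
      _ = _ := by ring
  · rw [steinMulDer, if_neg (not_le.2 hw)]
    refine le_trans ?_ (mills_le_inv hz)
    have hw0 : 0 < w := hz.trans hw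
    have hm : mills w ≤ mills z := antitone_mills hw.le
    have h1 : (1 + w ^ 2) * mills w - w ≤ mills w := by nlinarith [mul_mills_le w]
    have h2 := le_one_add_sq_mul_mills w
    calc gaussLower z * ((1 + w ^ 2) * mills w - w) ≤ 1 * ((1 + w ^ 2) * mills w - w) := by
          refine mul_le_mul_of_nonneg_right (gaussLower_le_one z) ?_
          linarith
      _ ≤ mills z := by linarith

/-- By convexity in `l = w² / z²`, the exponential on `[0, z]` lies below the chord from `E` to `1`.
The quadratic is chosen to take the values `E / z` at `0` and `(1 + z²) / z` at `z`, so that its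
expectation needs only second moments. -/
lemma steinMulDer_le_quadratic {z : ℝ} (hz : 0 < z) (w : ℝ) :
    steinMulDer z w ≤ Real.exp (-z ^ 2 / 2) / z
      + (1 + z ^ 2 - Real.exp (-z ^ 2 / 2)) / z ^ 3 * w ^ 2 := by
  obtain ⟨h1, h2, h3⟩ := steinMulDer_le (w := w) hz
  set E := Real.exp (-z ^ 2 / 2) with hE
  have hE1 : E ≤ 1 := Real.exp_le_one_iff.2 (by nlinarith [sq_nonneg z])
  have hE0 : 0 < E := Real.exp_pos _
  have hc : 0 ≤ (1 + z ^ 2 - E) / z ^ 3 := by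
    have : 0 ≤ 1 + z ^ 2 - E := by nlinarith [sq_nonneg z]
    positivity
  rcases le_total w 0 with hw | hw
  · nlinarith [h1 hw, mul_nonneg hc (sq_nonneg w)]
  rcases le_or_gt w z with hwz | hwz
  · refine (h2 hw hwz).trans ?_
    set l := w ^ 2 / z ^ 2 with hl
    have hl0 : 0 ≤ l := by positivity
    have hl1 : l ≤ 1 := by
      rw [hl, div_le_one (by positivity)]
      gcongr
    have hw2 : w ^ 2 = l * z ^ 2 := by rw [hl]; field_simp
    have hexp : Real.exp ((w ^ 2 - z ^ 2) / 2) ≤ (1 - l) * E + l := by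
      have := exp_le_chord (a := z ^ 2 / 2) hl0 hl1
      convert this using 2
      · rw [hw2]; ring
      · rw [hE]; ring_nf
    have : E / z + (1 + z ^ 2 - E) / z ^ 3 * w ^ 2 = (E + (1 + z ^ 2 - E) * l) / z := by
      rw [hl]; field_simp
    rw [this]
    refine div_le_div_of_nonneg_right ?_ hz.le
    refine (mul_le_mul_of_nonneg_left hexp (by positivity)).trans ?_
    rw [hw2]
    -- This product is exactly the gap between the quadratic and the product of `1 + l z²` with the
    -- chord.
    have : 0 ≤ l * z ^ 2 * (1 - l) * (1 - E) :=
      mul_nonneg (mul_nonneg (by positivity) (by linarith)) (by linarith)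
    nlinarith
  · refine (h3 hwz).trans ?_
    have : E / z + (1 + z ^ 2 - E) / z ^ 3 * z ^ 2 = (1 + z ^ 2) / z := by field_simp; ring
    calc 1 / z ≤ (1 + z ^ 2) / z := by gcongr; nlinarith [sq_nonneg z]
      _ = E / z + (1 + z ^ 2 - E) / z ^ 3 * z ^ 2 := this.symm
      _ ≤ _ := by gcongr

/-- The quartic envelope used for large `z`. -/
noncomputable def quarticEnvelope (z w : ℝ) : ℝ :=
  2 * Real.exp (-z ^ 2 / 2) + 2 * w ^ 4 / z ^ 4

/-- The chord bound is applied to the square root of the exponential and then squared: `(a + l)² ≤ 2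
a² + 2 l²` turns `l = w² / z²` into a fourth power. -/
lemma exp_le_quarticEnvelope {z w : ℝ} (hw : 0 ≤ w) (hwz : w ≤ z) (hz : 0 < z) :
    Real.exp ((w ^ 2 - z ^ 2) / 2) ≤ quarticEnvelope z w := by
  set l := w ^ 2 / z ^ 2 with hl
  have hl0 : 0 ≤ l := by positivity
  have hl1 : l ≤ 1 := by
    rw [hl, div_le_one (by positivity)]
    gcongr
  have hw2 : w ^ 2 = l * z ^ 2 := by rw [hl]; field_simp
  have h := exp_le_chord (a := z ^ 2 / 4) hl0 hl1
  have e1 : Real.exp ((w ^ 2 - z ^ 2) / 2) = Real.exp (-(1 - l) * (z ^ 2 / 4)) ^ 2 := by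
    rw [← Real.exp_nat_mul, hw2]; congr 1; push_cast; ring
  have e2 : Real.exp (-z ^ 2 / 2) = Real.exp (-(z ^ 2 / 4)) ^ 2 := by
    rw [← Real.exp_nat_mul]; congr 1; push_cast; ring
  have e3 : 2 * w ^ 4 / z ^ 4 = 2 * l ^ 2 := by rw [hl]; field_simp
  rw [quarticEnvelope, e1, e2, e3]
  set a := Real.exp (-(z ^ 2 / 4))
  have ha : 0 < a := Real.exp_pos _
  calc Real.exp (-(1 - l) * (z ^ 2 / 4)) ^ 2 ≤ ((1 - l) * a + l) ^ 2 := by gcongr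
    _ ≤ (a + l) ^ 2 := by
        have : 0 ≤ (1 - l) * a := mul_nonneg (by linarith) ha.le
        gcongr
        nlinarith
    _ ≤ _ := by nlinarith [sq_nonneg (a - l)]

lemma quarticEnvelope_nonneg (z w : ℝ) : 0 ≤ quarticEnvelope z w := by
  unfold quarticEnvelope; positivity

lemma two_mul_exp_le_quarticEnvelope (z w : ℝ) :
    2 * Real.exp (-z ^ 2 / 2) ≤ quarticEnvelope z w := by
  unfold quarticEnvelope
  have : 0 ≤ 2 * w ^ 4 / z ^ 4 := by positivity
  linarith

lemma two_le_quarticEnvelope {z w : ℝ} (hz : 0 < z) (hw : z ≤ w) : 2 ≤ quarticEnvelope z w := by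
  unfold quarticEnvelope
  have : 2 ≤ 2 * w ^ 4 / z ^ 4 := by
    rw [le_div_iff₀ (by positivity)]
    gcongr
  linarith [Real.exp_pos (-z ^ 2 / 2)]

lemma steinSol_le_quarticEnvelope {z : ℝ} (hz : 0 < z) (w : ℝ) :
    steinSol z w ≤ quarticEnvelope z w / z := by
  rcases le_total w 0 with hw | hw
  · rw [steinSol_of_le (hw.trans hz.le)]
    refine (gaussUpper_mul_mills_le hz (neg_nonneg.2 hw)).trans ?_
    have := two_mul_exp_le_quarticEnvelope z w
    have h0 := Real.exp_pos (-z ^ 2 / 2)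
    gcongr
    linarith
  rcases le_total w z with hwz | hwz
  · rw [steinSol_of_le hwz]
    have h1 := gaussUpper_mul_mills_neg_le hz w
    have h2 := exp_le_quarticEnvelope hw hwz hz
    calc gaussUpper z * mills (-w)
        ≤ gaussUpper z * (√(2 * Real.pi) * Real.exp (w ^ 2 / 2)) := by
          refine mul_le_mul_of_nonneg_left ?_ (gaussUpper_pos z).le
          rw [mills_neg]
          linarith [mills_pos w]
      _ ≤ _ := h1
      _ ≤ _ := by gcongr
  · refine (steinSol_le_inv hz w).trans ?_
    have := two_le_quarticEnvelope hz hwz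
    gcongr
    linarith

lemma abs_steinDer_le_quarticEnvelope {S : Set ℝ} {z : ℝ} (hS : IsLeftRay S z) (hz : 1 ≤ z)
    (w : ℝ) : |steinDer S z w| ≤ 2 * quarticEnvelope z w := by
  have hz0 : 0 < z := by linarith
  have h0 := two_mul_exp_le_quarticEnvelope z w
  have hE := Real.exp_pos (-z ^ 2 / 2)
  have hq : gaussUpper z ≤ Real.exp (-z ^ 2 / 2) := by
    refine (gaussUpper_le hz0).trans (div_le_self hE.le (by linarith))
  rcases le_or_gt z w with hw | hw
  · linarith [abs_steinDer_le_one hS hz0.le w, two_le_quarticEnvelope hz0 hw]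
  · rw [steinDer_of_mem z (hS.mem_of_lt hw), abs_of_nonneg
      (by linarith [neg_gaussUpper_le_mul_steinSol hw.le])]
    rcases le_total w 0 with hw0 | hw0
    · linarith [mul_nonpos_of_nonpos_of_nonneg hw0 (steinSol_pos z w).le]
    · have h1 := steinSol_le_quarticEnvelope hz0 w
      have h2 : w * steinSol z w ≤ quarticEnvelope z w := by
        calc w * steinSol z w ≤ z * (quarticEnvelope z w / z) := by gcongr; exact (steinSol_pos z w).le
          _ = _ := by field_simp
      linarith

lemma steinMulDer_le_quarticEnvelope {z : ℝ} (hz : 0 < z) (w : ℝ) :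
    steinMulDer z w ≤ (1 + z ^ 2) / z * quarticEnvelope z w := by
  obtain ⟨h1, h2, h3⟩ := steinMulDer_le (w := w) hz
  have hE := Real.exp_pos (-z ^ 2 / 2)
  have h0 := two_mul_exp_le_quarticEnvelope z w
  have hz2 := sq_nonneg z
  rw [div_mul_eq_mul_div]
  rcases le_total w 0 with hw | hw
  · refine (h1 hw).trans ?_
    gcongr
    nlinarith
  rcases le_or_gt w z with hwz | hwz
  · refine (h2 hw hwz).trans ?_
    have := exp_le_quarticEnvelope hw hwz hz
    gcongr
  · refine (h3 hwz).trans ?_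
    have := two_le_quarticEnvelope hz hwz.le
    gcongr
    nlinarith

/-- If `Q'` dominates the derivative of `w ↦ w * steinSol z w`, increments of `Q` dominate
its increments. -/
lemma mul_steinSol_sub_le {z : ℝ} {Q Q' : ℝ → ℝ} (hQ : ∀ w, HasDerivAt Q (Q' w) w)
    (hle : ∀ w, steinMulDer z w ≤ Q' w) {u v : ℝ} (huv : u ≤ v) :
    v * steinSol z v - u * steinSol z u ≤ Q v - Q u := by
  have h : Monotone fun w => Q w - w * steinSol z w :=
    monotone_of_hasDerivAt_of_ne (z := z)
      ((continuous_iff_continuousAt.2 fun w => (hQ w).continuousAt).sub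
        (continuous_mul_steinSol z))
      (fun w hw => (hQ w).sub (hasDerivAt_mul_steinSol hw)) fun w _ => by linarith [hle w]
  have := h huv
  simp only at this
  linarith

/-! ### Sums of independent bounded summands -/

/-- Independent summands bounded by one, almost centred, with total second moment `1 - b₂` and
total third absolute moment `b₃`. -/
structure TruncatedSummands {Ω ι : Type*} [MeasurableSpace Ω] [Fintype ι] (P : Measure Ω)
    (X : ι → Ω → ℝ) (b₂ b₃ : ℝ) : Prop where
  meas : ∀ i, Measurable (X i)
  indep : iIndepFun X P
  bdd : ∀ i ω, |X i ω| ≤ 1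
  mean : ∑ i, |∫ ω, X i ω ∂P| ≤ b₂
  second : ∑ i, ∫ ω, X i ω ^ 2 ∂P = 1 - b₂
  third : ∑ i, ∫ ω, |X i ω| ^ 3 ∂P = b₃

lemma integrable_of_abs_le {Ω : Type*} [MeasurableSpace Ω] {P : Measure Ω} [IsFiniteMeasure P]
    {f : Ω → ℝ} (hf : Measurable f) {C : ℝ} (hC : ∀ ω, |f ω| ≤ C) : Integrable f P :=
  Integrable.of_bound hf.aestronglyMeasurable C (ae_of_all _ hC)

/-- Fubini on the product law: in an expectation, `X` may be frozen while the independent `V` is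
averaged. -/
lemma integral_comp_of_indepFun {Ω : Type*} [MeasurableSpace Ω] {P : Measure Ω}
    [IsProbabilityMeasure P] {X V : Ω → ℝ} (hX : Measurable X) (hV : Measurable V)
    (h : IndepFun X V P) {φ : ℝ → ℝ → ℝ} (hφ : Measurable (Function.uncurry φ))
    (hint : Integrable (fun ω => φ (X ω) (V ω)) P) :
    ∫ ω, φ (X ω) (V ω) ∂P = ∫ ω, ∫ ω', φ (X ω) (V ω') ∂P ∂P := by
  have hmap := (indepFun_iff_map_prod_eq_prod_map_map hX.aemeasurable hV.aemeasurable).1 h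
  have hpair : Measurable fun ω => (X ω, V ω) := hX.prodMk hV
  have := Measure.isProbabilityMeasure_map (μ := P) hX.aemeasurable
  have := Measure.isProbabilityMeasure_map (μ := P) hV.aemeasurable
  have hint' : Integrable (Function.uncurry φ) ((P.map X).prod (P.map V)) := by
    rw [← hmap, integrable_map_measure hφ.aestronglyMeasurable hpair.aemeasurable]
    exact hint
  have e1 : ∫ ω, φ (X ω) (V ω) ∂P
      = ∫ p, Function.uncurry φ p ∂(P.map fun ω => (X ω, V ω)) := by
    rw [integral_map hpair.aemeasurable hφ.aestronglyMeasurable]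
    rfl
  rw [e1, hmap, integral_prod _ hint', integral_map hX.aemeasurable
    hint'.integral_prod_left.aestronglyMeasurable]
  congr 1 with ω
  rw [integral_map hV.aemeasurable]
  · rfl
  · exact (hφ.comp measurable_prodMk_left).aestronglyMeasurable

section TruncatedSummands

variable {Ω ι : Type*} [MeasurableSpace Ω] [Fintype ι] {P : Measure Ω} [IsProbabilityMeasure P]
  {X : ι → Ω → ℝ} {b₂ b₃ : ℝ}

/-- The partial sum over a finite set of indices. -/
def psum (X : ι → Ω → ℝ) (s : Finset ι) (ω : Ω) : ℝ := ∑ j ∈ s, X j ω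

namespace TruncatedSummands

lemma b₂_nonneg (h : TruncatedSummands P X b₂ b₃) : 0 ≤ b₂ :=
  (Finset.sum_nonneg fun _ _ => abs_nonneg _).trans h.mean

lemma b₂_le_one (h : TruncatedSummands P X b₂ b₃) : b₂ ≤ 1 := by
  have : 0 ≤ ∑ i, ∫ ω, X i ω ^ 2 ∂P :=
    Finset.sum_nonneg fun _ _ => integral_nonneg fun _ => sq_nonneg _
  linarith [h.second]

lemma b₃_nonneg (h : TruncatedSummands P X b₂ b₃) : 0 ≤ b₃ := by
  rw [← h.third]
  exact Finset.sum_nonneg fun _ _ => integral_nonneg fun _ => by positivity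

lemma measurable_psum (h : TruncatedSummands P X b₂ b₃) (s : Finset ι) :
    Measurable (psum X s) :=
  Finset.measurable_fun_sum s fun i _ => h.meas i

lemma abs_psum_le (h : TruncatedSummands P X b₂ b₃) (s : Finset ι) (ω : Ω) :
    |psum X s ω| ≤ s.card := by
  refine (Finset.abs_sum_le_sum_abs _ _).trans ?_
  refine (Finset.sum_le_card_nsmul _ _ 1 fun i _ => h.bdd i ω).trans ?_
  simp

lemma integrable_pow (h : TruncatedSummands P X b₂ b₃) (i : ι) (k : ℕ) :
    Integrable (fun ω => X i ω ^ k) P :=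
  integrable_of_abs_le ((h.meas i).pow_const k) (C := 1) fun ω => by
    rw [abs_pow]; exact pow_le_one₀ (abs_nonneg _) (h.bdd i ω)

lemma integrable (h : TruncatedSummands P X b₂ b₃) (i : ι) : Integrable (X i) P := by
  simpa using h.integrable_pow i 1

lemma integrable_abs_pow (h : TruncatedSummands P X b₂ b₃) (i : ι) (k : ℕ) :
    Integrable (fun ω => |X i ω| ^ k) P := by
  simpa [abs_pow] using (h.integrable_pow i k).abs

lemma integrable_psum_pow (h : TruncatedSummands P X b₂ b₃) (s : Finset ι) (k : ℕ) :
    Integrable (fun ω => psum X s ω ^ k) P :=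
  integrable_of_abs_le ((h.measurable_psum s).pow_const k) (C := (s.card : ℝ) ^ k) fun ω => by
    rw [abs_pow]; exact pow_le_pow_left₀ (abs_nonneg _) (h.abs_psum_le s ω) k

lemma integrable_psum (h : TruncatedSummands P X b₂ b₃) (s : Finset ι) :
    Integrable (psum X s) P := by
  simpa using h.integrable_psum_pow s 1

lemma psum_insert [DecidableEq ι] {s : Finset ι} {i : ι} (hi : i ∉ s) (ω : Ω) :
    psum X (insert i s) ω = X i ω + psum X s ω := Finset.sum_insert hi

lemma psum_erase [DecidableEq ι] {s : Finset ι} {i : ι} (hi : i ∈ s) (ω : Ω) :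
    psum X (s.erase i) ω = psum X s ω - X i ω :=
  eq_sub_of_add_eq (Finset.sum_erase_add s _ hi)

lemma indepFun_psum (h : TruncatedSummands P X b₂ b₃) {s : Finset ι} {i : ι} (hi : i ∉ s) :
    IndepFun (X i) (psum X s) P := by
  have := (h.indep.indepFun_finsetSum_of_notMem h.meas hi).symm
  convert this using 1
  ext ω
  simp [psum]

lemma integral_mul_comp_psum (h : TruncatedSummands P X b₂ b₃) {s : Finset ι} {i : ι}
    (hi : i ∉ s) {f : ℝ → ℝ} (hf : Measurable f) :
    ∫ ω, X i ω * f (psum X s ω) ∂P = (∫ ω, X i ω ∂P) * ∫ ω, f (psum X s ω) ∂P :=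
  ((h.indepFun_psum hi).comp measurable_id hf).integral_mul_eq_mul_integral
    (h.meas i).aestronglyMeasurable (hf.comp (h.measurable_psum s)).aestronglyMeasurable

lemma integral_psum (h : TruncatedSummands P X b₂ b₃) (s : Finset ι) :
    ∫ ω, psum X s ω ∂P = ∑ i ∈ s, ∫ ω, X i ω ∂P :=
  integral_finsetSum s fun i _ => h.integrable i

lemma abs_sum_mean_le (h : TruncatedSummands P X b₂ b₃) (s : Finset ι) :
    ∑ i ∈ s, |∫ ω, X i ω ∂P| ≤ b₂ :=
  (Finset.sum_le_univ_sum_of_nonneg fun _ => abs_nonneg _).trans h.mean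

lemma abs_integral_psum_le (h : TruncatedSummands P X b₂ b₃) (s : Finset ι) :
    |∫ ω, psum X s ω ∂P| ≤ b₂ := by
  rw [h.integral_psum]
  exact (Finset.abs_sum_le_sum_abs _ _).trans (h.abs_sum_mean_le s)

lemma sum_second_le (h : TruncatedSummands P X b₂ b₃) (s : Finset ι) :
    ∑ i ∈ s, ∫ ω, X i ω ^ 2 ∂P ≤ 1 - b₂ :=
  (Finset.sum_le_univ_sum_of_nonneg fun _ => integral_nonneg fun _ => sq_nonneg _).trans
    h.second.le

lemma memLp (h : TruncatedSummands P X b₂ b₃) (i : ι) : MemLp (X i) 2 P :=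
  MemLp.of_bound (h.meas i).aestronglyMeasurable 1 (ae_of_all _ (h.bdd i))

lemma variance_psum_le (h : TruncatedSummands P X b₂ b₃) (s : Finset ι) :
    Var[psum X s; P] ≤ 1 - b₂ := by
  have e : psum X s = ∑ i ∈ s, X i := by ext ω; simp [psum]
  rw [e, IndepFun.variance_sum (fun i _ => h.memLp i)
    fun i _ j _ hij => h.indep.indepFun hij]
  refine (Finset.sum_le_sum fun i _ => ?_).trans (h.sum_second_le s)
  exact variance_le_expectation_sq (h.meas i).aestronglyMeasurable

/-- Variance plus squared mean. The exact form is kept, since its `-b₂` later cancels a mean term.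
-/
lemma integral_psum_sq_le (h : TruncatedSummands P X b₂ b₃) (s : Finset ι) :
    ∫ ω, psum X s ω ^ 2 ∂P ≤ 1 - b₂ + b₂ ^ 2 := by
  have hL : MemLp (psum X s) 2 P :=
    MemLp.of_bound (h.measurable_psum s).aestronglyMeasurable s.card
      (ae_of_all _ (h.abs_psum_le s))
  have h1 := variance_eq_sub hL
  have h2 := h.variance_psum_le s
  have h3 : (∫ ω, psum X s ω ∂P) ^ 2 ≤ b₂ ^ 2 :=
    sq_le_sq' (neg_le_of_abs_le (h.abs_integral_psum_le s))
      (le_of_abs_le (h.abs_integral_psum_le s))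
  simp only [Pi.pow_apply] at h1
  linarith

lemma integral_psum_sq_le_one (h : TruncatedSummands P X b₂ b₃) (s : Finset ι) :
    ∫ ω, psum X s ω ^ 2 ∂P ≤ 1 := by
  nlinarith [h.integral_psum_sq_le s, h.b₂_nonneg, h.b₂_le_one]

lemma integral_abs_psum_le (h : TruncatedSummands P X b₂ b₃) (s : Finset ι) :
    ∫ ω, |psum X s ω| ∂P ≤ 1 := by
  have h1 : ∫ ω, |psum X s ω| ∂P ≤ ∫ ω, (1 + psum X s ω ^ 2) / 2 ∂P := by
    refine integral_mono (h.integrable_psum s).abs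
      (((integrable_const 1).add (h.integrable_psum_pow s 2)).div_const 2) fun ω => ?_
    simp only
    nlinarith [sq_nonneg (|psum X s ω| - 1), sq_abs (psum X s ω)]
  rw [integral_div, integral_add (integrable_const 1) (h.integrable_psum_pow s 2)] at h1
  simp only [integral_const, probReal_univ, smul_eq_mul, mul_one] at h1
  linarith [h.integral_psum_sq_le_one s]

end TruncatedSummands

/-! ### The concentration inequality -/

/-- Truncation of the identity to `[a, b]`. -/
noncomputable def clamp (a b w : ℝ) : ℝ := max a (min w b)

lemma continuous_clamp (a b : ℝ) : Continuous (clamp a b) := by unfold clamp; fun_prop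

lemma clamp_mem {a b : ℝ} (hab : a ≤ b) (w : ℝ) : a ≤ clamp a b w ∧ clamp a b w ≤ b :=
  ⟨le_max_left _ _, max_le hab (min_le_right _ _)⟩

lemma monotone_clamp (a b : ℝ) : Monotone (clamp a b) := fun _ _ h =>
  max_le_max le_rfl (min_le_min h le_rfl)

lemma mul_clamp_sub_nonneg (a b w x : ℝ) : 0 ≤ x * (clamp a b w - clamp a b (w - x)) := by
  rcases le_total 0 x with hx | hx
  · exact mul_nonneg hx (sub_nonneg.2 (monotone_clamp a b (by linarith)))
  · exact mul_nonneg_of_nonpos_of_nonpos hx (sub_nonpos.2 (monotone_clamp a b (by linarith)))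

/-- For `w` in `[a, b]` there is room `d` on both sides before the clamp saturates, so a shift by
`x` changes the clamped value by at least `min |x| d`, with the sign of `x`. -/
lemma le_mul_clamp_sub {a b w d : ℝ} (hd : 0 ≤ d) (haw : a ≤ w) (hwb : w ≤ b) (x : ℝ) :
    |x| * min |x| d ≤ x * (clamp (a - d) (b + d) w - clamp (a - d) (b + d) (w - x)) := by
  have hw : clamp (a - d) (b + d) w = w := by
    rw [clamp, min_eq_left (by linarith), max_eq_right (by linarith)]
  rw [hw]
  rcases le_total 0 x with hx | hx
  · rw [abs_of_nonneg hx]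
    refine mul_le_mul_of_nonneg_left ?_ hx
    have : clamp (a - d) (b + d) (w - x) ≤ w - min x d :=
      max_le (by linarith [min_le_right x d]) ((min_le_left _ _).trans
        (by linarith [min_le_left x d]))
    linarith
  · rw [abs_of_nonpos hx]
    have : w + min (-x) d ≤ clamp (a - d) (b + d) (w - x) :=
      le_max_of_le_right (le_min (by linarith [min_le_left (-x) d])
        (by linarith [min_le_right (-x) d]))
    nlinarith

namespace TruncatedSummands

/-- With `g` the clamp to `[a - d, b + d]` minus `c`, the sum of `X j * (g V - g (V - X j))` is
never negative, and on `V ∈ [a, b]` it dominates `Z = ∑ |X j| min (|X j|, d)`. Its expectation is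
computable by independence, while `Z` stays near its mean since its variance is at most `d²`. The
parameter `e` is the loss allowed in replacing `Z` by its mean, and `c` is a free centring; both are
tuned to the range of `z`. -/
theorem concentration [DecidableEq ι] (h : TruncatedSummands P X b₂ b₃) (s : Finset ι)
    {a b d e : ℝ} (hd : 0 < d) (he : 0 < e) (hab : a ≤ b) (c : ℝ) :
    ((∑ j ∈ s, ∫ ω, |X j ω| * min |X j ω| d ∂P) - e)
        * P.real {ω | psum X s ω ∈ Set.Icc a b}
      ≤ (∫ ω, psum X s ω * (clamp (a - d) (b + d) (psum X s ω) - c) ∂P)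
        - ∑ j ∈ s, (∫ ω, X j ω ∂P)
            * ∫ ω, (clamp (a - d) (b + d) (psum X (s.erase j) ω) - c) ∂P
        + d ^ 2 / (4 * e) := by
  set f : ℝ → ℝ := fun w => clamp (a - d) (b + d) w - c with hf
  have hfm : Measurable f := (continuous_clamp _ _).measurable.sub_const c
  have hab' : a - d ≤ b + d := by linarith
  have hfb : ∀ w, |f w| ≤ |a - d| + |b + d| + |c| := fun w => by
    obtain ⟨h1, h2⟩ := clamp_mem hab' w
    have h3 := abs_sub (clamp (a - d) (b + d) w) c
    have h4 : |clamp (a - d) (b + d) w| ≤ |a - d| + |b + d| := by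
      rw [abs_le]
      constructor
      · linarith [neg_abs_le (a - d), abs_nonneg (b + d)]
      · linarith [le_abs_self (b + d), abs_nonneg (a - d)]
    linarith
  set K := |a - d| + |b + d| + |c|
  have hK : 0 ≤ K := by positivity
  set g : ℝ → ℝ := fun x => |x| * min |x| d with hg
  have hgm : Measurable g := by fun_prop
  have hg0 : ∀ x, 0 ≤ g x := fun x => mul_nonneg (abs_nonneg _) (le_min (abs_nonneg _) hd.le)
  have hgd : ∀ x, g x ≤ d * |x| := fun x => by
    rw [mul_comm d]; exact mul_le_mul_of_nonneg_left (min_le_right _ _) (abs_nonneg x)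
  set Y : ι → Ω → ℝ := fun j ω => g (X j ω) with hY
  have hYm : ∀ j, Measurable (Y j) := fun j => hgm.comp (h.meas j)
  have hYb : ∀ j ω, |Y j ω| ≤ d := fun j ω => by
    rw [abs_of_nonneg (hg0 _)]
    exact (hgd _).trans (mul_le_of_le_one_right hd.le (h.bdd j ω))
  have hYL : ∀ j, MemLp (Y j) 2 P := fun j =>
    MemLp.of_bound (hYm j).aestronglyMeasurable d (ae_of_all _ (hYb j))
  have hYind : iIndepFun Y P := h.indep.comp (fun _ => g) fun _ => hgm
  set κ := ∑ j ∈ s, ∫ ω, Y j ω ∂P with hκ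
  set Z : Ω → ℝ := fun ω => ∑ j ∈ s, Y j ω with hZ
  have hZeq : Z = ∑ j ∈ s, Y j := by ext ω; simp [hZ]
  have hZL : MemLp Z 2 P := by rw [hZeq]; exact memLp_finsetSum' s fun j _ => hYL j
  have hZmean : ∫ ω, Z ω ∂P = κ := integral_finsetSum s fun j _ => (hYL j).integrable (by norm_num)
  have hZvar : ∫ ω, (Z ω - κ) ^ 2 ∂P ≤ d ^ 2 := by
    rw [← hZmean, ← variance_eq_integral hZL.aestronglyMeasurable.aemeasurable, hZeq,
      IndepFun.variance_sum (fun j _ => hYL j) fun i _ j _ hij => hYind.indepFun hij]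
    calc ∑ j ∈ s, Var[Y j; P] ≤ ∑ j ∈ s, d ^ 2 * ∫ ω, X j ω ^ 2 ∂P := by
          refine Finset.sum_le_sum fun j _ => ?_
          refine (variance_le_expectation_sq (hYm j).aestronglyMeasurable).trans ?_
          rw [← integral_const_mul]
          refine integral_mono (hYL j).integrable_sq ((h.integrable_pow j 2).const_mul _)
            fun ω => ?_
          have := pow_le_pow_left₀ (hg0 _) (hgd (X j ω)) 2
          simpa [mul_pow] using this
      _ = d ^ 2 * ∑ j ∈ s, ∫ ω, X j ω ^ 2 ∂P := by rw [Finset.mul_sum]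
      _ ≤ d ^ 2 * 1 := by
          gcongr
          linarith [h.sum_second_le s, h.b₂_nonneg]
      _ = d ^ 2 := mul_one _
  set A : Set Ω := {ω | psum X s ω ∈ Set.Icc a b} with hA
  have hAm : MeasurableSet A := h.measurable_psum s measurableSet_Icc
  have hfV : ∀ t, Measurable fun ω => f (psum X t ω) := fun t => hfm.comp (h.measurable_psum t)
  have hXf : ∀ j t, Integrable (fun ω => X j ω * f (psum X t ω)) P := fun j t =>
    integrable_of_abs_le ((h.meas j).mul (hfV t)) (C := 1 * K) fun ω => by
      rw [abs_mul]
      exact mul_le_mul (h.bdd j ω) (hfb _) (abs_nonneg _) zero_le_one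
  have hpoint : ∀ ω, A.indicator (fun _ => κ - e) ω - (Z ω - κ) ^ 2 / (4 * e)
      ≤ ∑ j ∈ s, (X j ω * f (psum X s ω) - X j ω * f (psum X (s.erase j) ω)) := by
    intro ω
    have hterm : ∀ j ∈ s, X j ω * f (psum X s ω) - X j ω * f (psum X (s.erase j) ω)
        = X j ω * (clamp (a - d) (b + d) (psum X s ω)
          - clamp (a - d) (b + d) (psum X s ω - X j ω)) := fun j hj => by
      rw [psum_erase hj]; simp only [hf]; ring
    rw [Finset.sum_congr rfl hterm]
    by_cases hω : ω ∈ A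
    · rw [Set.indicator_of_mem hω]
      have hle : Z ω ≤ ∑ j ∈ s, X j ω * (clamp (a - d) (b + d) (psum X s ω)
          - clamp (a - d) (b + d) (psum X s ω - X j ω)) :=
        Finset.sum_le_sum fun j _ => le_mul_clamp_sub hd.le hω.1 hω.2 (X j ω)
      refine le_trans ?_ hle
      -- Young's inequality in the form `(2e + (Z - κ))² ≥ 0` replaces `Z` by its mean without
      -- multiplying a fluctuation by the event.
      have : κ - Z ω ≤ e + (Z ω - κ) ^ 2 / (4 * e) := by
        rw [← sub_le_iff_le_add', le_div_iff₀ (by positivity)]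
        nlinarith [sq_nonneg (2 * e + (Z ω - κ))]
      linarith
    · rw [Set.indicator_of_notMem hω]
      have h1 : 0 ≤ (Z ω - κ) ^ 2 / (4 * e) := by positivity
      have h2 : 0 ≤ ∑ j ∈ s, X j ω * (clamp (a - d) (b + d) (psum X s ω)
          - clamp (a - d) (b + d) (psum X s ω - X j ω)) :=
        Finset.sum_nonneg fun j _ => mul_clamp_sub_nonneg _ _ _ _
      linarith
  have hZi : Integrable (fun ω => (Z ω - κ) ^ 2 / (4 * e)) P :=
    ((hZL.sub (memLp_const κ)).integrable_sq).div_const _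
  have hXd : ∀ j, Integrable
      (fun ω => X j ω * f (psum X s ω) - X j ω * f (psum X (s.erase j) ω)) P := fun j =>
    (hXf j s).sub (hXf j (s.erase j))
  have hint : ∫ ω, (A.indicator (fun _ => κ - e) ω - (Z ω - κ) ^ 2 / (4 * e)) ∂P
      ≤ ∫ ω, ∑ j ∈ s, (X j ω * f (psum X s ω) - X j ω * f (psum X (s.erase j) ω)) ∂P :=
    integral_mono (((integrable_const (κ - e)).indicator hAm).sub hZi)
    (integrable_finsetSum s fun j _ => hXd j) hpoint
  rw [integral_sub ((integrable_const (κ - e)).indicator hAm) hZi, integral_indicator_const _ hAm,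
    integral_div, integral_finsetSum s fun j _ => hXd j] at hint
  have hsplit : ∑ j ∈ s, ∫ ω, (X j ω * f (psum X s ω) - X j ω * f (psum X (s.erase j) ω)) ∂P
      = (∫ ω, psum X s ω * f (psum X s ω) ∂P)
        - ∑ j ∈ s, (∫ ω, X j ω ∂P) * ∫ ω, f (psum X (s.erase j) ω) ∂P := by
    have e1 : ∫ ω, psum X s ω * f (psum X s ω) ∂P = ∑ j ∈ s, ∫ ω, X j ω * f (psum X s ω) ∂P := by
      rw [← integral_finsetSum s fun j _ => hXf j s]
      congr 1 with ω
      conv_lhs => rw [psum, Finset.sum_mul]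
      rfl
    rw [e1, ← Finset.sum_sub_distrib]
    refine Finset.sum_congr rfl fun j _ => ?_
    rw [integral_sub (hXf j s) (hXf j (s.erase j)),
      h.integral_mul_comp_psum (Finset.notMem_erase j s) hfm]
  rw [hsplit, smul_eq_mul, mul_comm] at hint
  have : (∫ ω, (Z ω - κ) ^ 2 ∂P) / (4 * e) ≤ d ^ 2 / (4 * e) := by gcongr
  linarith

end TruncatedSummands

end TruncatedSummands

/-! ### Uniform concentration and the Stein error bound -/

section SteinBound

variable {Ω ι : Type*} [MeasurableSpace Ω] [Fintype ι] {P : Measure Ω} [IsProbabilityMeasure P]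
  {X : ι → Ω → ℝ} {b₂ b₃ : ℝ}

lemma abs_integral_le_of_abs_le {f g : Ω → ℝ} (hg : Integrable g P) (h : ∀ ω, |f ω| ≤ g ω) :
    |∫ ω, f ω ∂P| ≤ ∫ ω, g ω ∂P :=
  norm_integral_le_of_norm_le (f := f) hg (ae_of_all _ h)

lemma abs_integral_le_const {f : Ω → ℝ} {K : ℝ} (h : ∀ ω, |f ω| ≤ K) : |∫ ω, f ω ∂P| ≤ K := by
  simpa using norm_integral_le_of_norm_le_const (μ := P) (f := f) (ae_of_all _ h)

lemma sub_le_mul_min {x d : ℝ} (hx : 0 ≤ x) (hd : 0 < d) :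
    x ^ 2 - x ^ 3 / (4 * d) ≤ x * min x d := by
  have h1 : x - x ^ 2 / (4 * d) ≤ min x d := by
    refine le_min ?_ ?_
    · have : 0 ≤ x ^ 2 / (4 * d) := by positivity
      linarith
    · rw [sub_le_iff_le_add', ← sub_le_iff_le_add, le_div_iff₀ (by positivity)]
      nlinarith [sq_nonneg (x - 2 * d)]
  calc x ^ 2 - x ^ 3 / (4 * d) = x * (x - x ^ 2 / (4 * d)) := by ring
    _ ≤ _ := by gcongr

lemma intervalIntegral_abs_zero (x : ℝ) : ∫ t in (0 : ℝ)..x, |t| = x * |x| / 2 := by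
  rcases le_total 0 x with hx | hx
  · rw [abs_of_nonneg hx, intervalIntegral.integral_congr (g := fun t => t)]
    · rw [integral_id]; ring
    · intro t ht
      rw [Set.uIcc_of_le hx] at ht
      exact abs_of_nonneg ht.1
  · rw [abs_of_nonpos hx, intervalIntegral.integral_congr (g := fun t => -t)]
    · rw [intervalIntegral.integral_neg, integral_id]; ring
    · intro t ht
      rw [Set.uIcc_of_ge hx] at ht
      exact abs_of_nonpos ht.2

namespace TruncatedSummands

lemma integrable_mul_min (h : TruncatedSummands P X b₂ b₃) (j : ι) (d : ℝ) :
    Integrable (fun ω => |X j ω| * min |X j ω| d) P := by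
  refine integrable_of_abs_le (C := 1 * (1 + |d|)) ?_ fun ω => ?_
  · exact (h.meas j).abs.mul ((h.meas j).abs.min measurable_const)
  · rw [abs_mul, abs_abs]
    refine mul_le_mul (h.bdd j ω) ?_ (abs_nonneg _) zero_le_one
    have := h.bdd j ω
    rw [abs_le]
    constructor
    · exact le_min (by linarith [abs_nonneg (X j ω), abs_nonneg d]) (by linarith [neg_abs_le d])
    · exact (min_le_left _ _).trans (by linarith [abs_nonneg d])

/-- Makes the coefficient in `concentration` bounded below: `x min(x, d) ≥ x² - x³ / (4d)` gives `1
- b₂ - b₃ / (4d)` for the full sum, and leaving out `i` costs at most `d E|X i|`. -/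
lemma le_sum_mul_min [DecidableEq ι] (h : TruncatedSummands P X b₂ b₃) {d : ℝ} (hd : 0 < d)
    (i : ι) : 1 - b₂ - b₃ / (4 * d) - d * ∫ ω, |X i ω| ∂P
      ≤ ∑ j ∈ Finset.univ.erase i, ∫ ω, |X j ω| * min |X j ω| d ∂P := by
  have h1 : 1 - b₂ - b₃ / (4 * d) ≤ ∑ j, ∫ ω, |X j ω| * min |X j ω| d ∂P := by
    rw [← h.second, ← h.third, Finset.sum_div, ← Finset.sum_sub_distrib]
    refine Finset.sum_le_sum fun j _ => ?_
    rw [← integral_div, ← integral_sub (h.integrable_pow j 2)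
      ((h.integrable_abs_pow j 3).div_const _)]
    refine integral_mono ((h.integrable_pow j 2).sub ((h.integrable_abs_pow j 3).div_const _))
      (h.integrable_mul_min j d) fun ω => ?_
    have := sub_le_mul_min (abs_nonneg (X j ω)) hd
    rwa [sq_abs] at this
  have h2 : ∫ ω, |X i ω| * min |X i ω| d ∂P ≤ d * ∫ ω, |X i ω| ∂P := by
    rw [← integral_const_mul]
    refine integral_mono (h.integrable_mul_min i d) ((h.integrable i).abs.const_mul d) fun ω => ?_
    simp only
    rw [mul_comm d]
    exact mul_le_mul_of_nonneg_left (min_le_right _ _) (abs_nonneg _)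
  rw [← Finset.add_sum_erase _ _ (Finset.mem_univ i)] at h1
  linarith

lemma integral_abs_pow_three_le (h : TruncatedSummands P X b₂ b₃) (i : ι) :
    ∫ ω, |X i ω| ^ 3 ∂P ≤ b₃ := by
  rw [← h.third]
  exact Finset.single_le_sum (f := fun i => ∫ ω, |X i ω| ^ 3 ∂P)
    (fun _ _ => integral_nonneg fun _ => by positivity) (Finset.mem_univ i)

lemma integral_abs_cube_le (h : TruncatedSummands P X b₂ b₃) (i : ι) :
    (∫ ω, |X i ω| ∂P) ^ 3 ≤ b₃ := by
  refine le_trans ?_ (h.integral_abs_pow_three_le i)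
  set m := ∫ ω, |X i ω| ∂P with hm
  have hm0 : 0 ≤ m := integral_nonneg fun _ => abs_nonneg _
  have h1 : ∫ ω, (3 * m ^ 2 * |X i ω| - 2 * m ^ 3) ∂P ≤ ∫ ω, |X i ω| ^ 3 ∂P := by
    refine integral_mono (((h.integrable i).abs.const_mul _).sub (integrable_const _))
      (h.integrable_abs_pow i 3) fun ω => ?_
    simp only
    have hx := abs_nonneg (X i ω)
    -- Tangent line of the cube at `m`: `x³ - 3 m² x + 2 m³ = (x + 2m)(x - m)²`.
    nlinarith [mul_nonneg (add_nonneg hx (mul_nonneg zero_le_two hm0)) (sq_nonneg (|X i ω| - m))]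
  rw [integral_sub ((h.integrable i).abs.const_mul _) (integrable_const _), integral_const_mul,
    ← hm] at h1
  simp only [integral_const, probReal_univ, one_smul] at h1
  nlinarith

lemma integral_abs_mul_sq_le (h : TruncatedSummands P X b₂ b₃) (i : ι) :
    (∫ ω, |X i ω| ∂P) * ∫ ω, X i ω ^ 2 ∂P ≤ ∫ ω, |X i ω| ^ 3 ∂P := by
  set m := ∫ ω, |X i ω| ∂P with hm
  have hm0 : 0 ≤ m := integral_nonneg fun _ => abs_nonneg _
  have hi := (h.integrable i).abs
  have hi2 : Integrable (fun ω => m ^ 2 * |X i ω| - m ^ 3) P :=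
    (hi.const_mul _).sub (integrable_const _)
  have h1 : ∫ ω, (m * X i ω ^ 2 + (m ^ 2 * |X i ω| - m ^ 3)) ∂P ≤ ∫ ω, |X i ω| ^ 3 ∂P := by
    refine integral_mono (((h.integrable_pow i 2).const_mul m).add hi2)
      (h.integrable_abs_pow i 3) fun ω => ?_
    simp only
    have hx := abs_nonneg (X i ω)
    rw [← sq_abs (X i ω)]
    -- Here `x³ - m x² - m² x + m³ = (x + m)(x - m)²`; the last two terms cancel in expectation.
    nlinarith [mul_nonneg (add_nonneg hx hm0) (sq_nonneg (|X i ω| - m))]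
  rw [integral_add ((h.integrable_pow i 2).const_mul m) hi2,
    integral_sub (hi.const_mul _) (integrable_const _), integral_const_mul, integral_const_mul,
    ← hm] at h1
  simp only [integral_const, probReal_univ, one_smul] at h1
  nlinarith

/-- Concentration of the leave-one-out sums. -/
theorem concentration_uniform [DecidableEq ι] (h : TruncatedSummands P X b₂ b₃)
    (hb0 : 0 < b₂ + b₃) (hb : b₂ + b₃ ≤ 2 / 37) (i : ι) {a b : ℝ} (hab : a ≤ b) :
    P.real {ω | psum X (Finset.univ.erase i) ω ∈ Set.Icc a b}
      ≤ 0.865 * (b - a) + 1.44 * (b₂ + b₃) := by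
  set s := Finset.univ.erase i with hs
  set β := b₂ + b₃ with hβ
  set d := 0.7 * β with hd
  have hd0 : 0 < d := by positivity
  have hb2 := h.b₂_nonneg
  have hb3 := h.b₃_nonneg
  -- The values `d = 0.7 β` and `e = 0.05` are numerical choices. Centring at the midpoint halves
  -- the sup norm of the test function to `L`.
  have hc := h.concentration s (e := 0.05) hd0 (by norm_num) hab ((a + b) / 2)
  set L := (b - a) / 2 + d with hL
  have hL0 : 0 ≤ L := by rw [hL]; linarith
  have hf : ∀ w, |clamp (a - d) (b + d) w - (a + b) / 2| ≤ L := fun w => by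
    obtain ⟨h1, h2⟩ := clamp_mem (show a - d ≤ b + d by linarith) w
    rw [abs_le]
    constructor <;> linarith
  have hfm : ∀ t, Measurable fun ω => clamp (a - d) (b + d) (psum X t ω) - (a + b) / 2 := fun t =>
    ((continuous_clamp _ _).measurable.comp (h.measurable_psum t)).sub_const _
  have h1 : ∫ ω, psum X s ω * (clamp (a - d) (b + d) (psum X s ω) - (a + b) / 2) ∂P ≤ L := by
    calc _ ≤ ∫ ω, L * |psum X s ω| ∂P := by
          refine integral_mono ?_ ((h.integrable_psum s).abs.const_mul L) fun ω => ?_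
          · refine integrable_of_abs_le ((h.measurable_psum s).mul (hfm s)) (C := s.card * L)
              fun ω => ?_
            rw [abs_mul]
            exact mul_le_mul (h.abs_psum_le s ω) (hf _) (abs_nonneg _) (Nat.cast_nonneg _)
          · refine (le_abs_self _).trans ?_
            rw [abs_mul, mul_comm]
            exact mul_le_mul_of_nonneg_right (hf _) (abs_nonneg _)
      _ = L * ∫ ω, |psum X s ω| ∂P := integral_const_mul _ _
      _ ≤ L * 1 := by gcongr; exact h.integral_abs_psum_le s
      _ = L := mul_one L
  have h2 : -(∑ j ∈ s, (∫ ω, X j ω ∂P)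
      * ∫ ω, (clamp (a - d) (b + d) (psum X (s.erase j) ω) - (a + b) / 2) ∂P) ≤ b₂ * L := by
    refine (neg_le_abs _).trans ((Finset.abs_sum_le_sum_abs _ _).trans ?_)
    calc _ ≤ ∑ j ∈ s, |∫ ω, X j ω ∂P| * L := by
          refine Finset.sum_le_sum fun j _ => ?_
          rw [abs_mul]
          refine mul_le_mul_of_nonneg_left ?_ (abs_nonneg _)
          exact abs_integral_le_const fun ω => hf _
      _ = (∑ j ∈ s, |∫ ω, X j ω ∂P|) * L := by rw [Finset.sum_mul]
      _ ≤ b₂ * L := by gcongr; exact h.abs_sum_mean_le s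
  have hκ := h.le_sum_mul_min hd0 i
  rw [← hs] at hκ
  set κ := ∑ j ∈ s, ∫ ω, |X j ω| * min |X j ω| d ∂P
  set m := ∫ ω, |X i ω| ∂P with hm
  have hm0 : 0 ≤ m := integral_nonneg fun _ => abs_nonneg _
  -- `0.379` slightly exceeds the cube root of `2 / 37`, and `m³ ≤ b₃ ≤ 2 / 37`.
  have hm1 : m ≤ 0.379 := by
    by_contra! hlt
    have := h.integral_abs_cube_le i
    have h3 : (0.379 : ℝ) ^ 3 ≤ m ^ 3 := pow_le_pow_left₀ (by norm_num) hlt.le 3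
    rw [← hm] at this
    norm_num at h3
    linarith
  set p := P.real {ω | psum X s ω ∈ Set.Icc a b} with hp
  have hp0 : 0 ≤ p := measureReal_nonneg
  have hmain : (κ - 0.05) * p ≤ L * (1 + b₂) + d ^ 2 / (4 * 0.05) := by linarith
  have hfrac : b₃ / (4 * d) = (1 - b₂ / β) / 2.8 := by
    rw [hd, show b₃ = β - b₂ by rw [hβ]; ring]; field_simp; ring
  -- `18.5 = 37 / 2` bounds `1 / β` below. The resulting gain in `b₂` pays both for the `-b₂` in the
  -- bound on `κ` and for the factor `1 + b₂`, which then cancels.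
  have hr : b₂ * 18.5 ≤ b₂ / β := by
    rw [le_div_iff₀ hb0]; nlinarith
  have hκ2 : 0.5785 * (1 + b₂) ≤ κ - 0.05 := by
    have : d * m ≤ 0.7 * (2 / 37) * 0.379 := by
      rw [hd]; exact mul_le_mul (by linarith) hm1 hm0 (by norm_num)
    rw [hfrac] at hκ
    generalize b₂ / β = r at hκ hr
    norm_num at this hκ hr ⊢
    linarith
  have hd2 : d ^ 2 / (4 * 0.05) ≤ 0.1892 * d := by
    rw [div_le_iff₀ (by norm_num)]
    nlinarith
  have h4 : 0.5785 * (1 + b₂) * p ≤ (L + 0.1892 * d) * (1 + b₂) := by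
    calc 0.5785 * (1 + b₂) * p ≤ (κ - 0.05) * p := by gcongr
      _ ≤ L * (1 + b₂) + 0.1892 * d := by linarith
      _ ≤ _ := by nlinarith
  have h5 : 0.5785 * p ≤ L + 0.1892 * d := by
    refine le_of_mul_le_mul_right ?_ (by linarith : 0 < 1 + b₂)
    linarith
  rw [hL, hd] at h5
  linarith

/-! ### Stein's identity -/

/-- The increment of `f` is the integral of `F t = E f'(V + t)`, and `E f'(W)` is the average of `F`
at an independent copy of `X i`. So the error integrates `|F t - c| ≤ A (|t| + E|X i|) + C` over `t`
between `0` and `x`. The factor `3 / 2` is `1 / 2` from integrating `|t|` plus `1` from `E|X| E X² ≤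
E|X|³`. -/
lemma stein_summand [DecidableEq ι] (h : TruncatedSummands P X b₂ b₃) {S : Set ℝ} {z : ℝ}
    (hS : IsLeftRay S z) (hz : 0 ≤ z) {A C : ℝ} (i : ι)
    (hF : ∀ s t, |s| ≤ 1 → |t| ≤ 1 →
      |(∫ ω, steinDer S z (psum X (Finset.univ.erase i) ω + s) ∂P)
        - ∫ ω, steinDer S z (psum X (Finset.univ.erase i) ω + t) ∂P| ≤ A * (|s| + |t|) + C)
    (hA : 0 ≤ A) :
    |(∫ ω, X i ω * steinSol z (psum X Finset.univ ω) ∂P)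
      - (∫ ω, X i ω ∂P) * (∫ ω, steinSol z (psum X (Finset.univ.erase i) ω) ∂P)
      - (∫ ω, steinDer S z (psum X Finset.univ ω) ∂P) * ∫ ω, X i ω ^ 2 ∂P|
      ≤ 3 / 2 * A * (∫ ω, |X i ω| ^ 3 ∂P) + C * ∫ ω, X i ω ^ 2 ∂P := by
  set V := psum X (Finset.univ.erase i) with hV
  have hVm : Measurable V := h.measurable_psum _
  have hXm := h.meas i
  have hind : IndepFun (X i) V P := h.indepFun_psum (Finset.notMem_erase i _)
  have hW : ∀ ω, psum X Finset.univ ω = V ω + X i ω := fun ω => by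
    rw [hV, psum_erase (Finset.mem_univ i)]; ring
  simp_rw [hW]
  set f := steinSol z with hf
  have hfm : Measurable f := (continuous_steinSol z).measurable
  have hfb : ∀ w, |f w| ≤ 1.26 := fun w => by
    rw [abs_of_pos (steinSol_pos z w)]; exact steinSol_le_of_nonneg hz w
  have hdm := measurable_steinDer hS
  have hdb := abs_steinDer_le_one hS hz
  set F : ℝ → ℝ := fun t => ∫ ω, steinDer S z (V ω + t) ∂P with hFdef
  have hFm : Measurable F := by
    have : StronglyMeasurable (Function.uncurry fun (t : ℝ) (ω : Ω) => steinDer S z (V ω + t)) :=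
      (hdm.comp ((hVm.comp measurable_snd).add measurable_fst)).stronglyMeasurable
    exact this.integral_prod_right.measurable
  have hFb : ∀ t, |F t| ≤ 1 := fun t => abs_integral_le_const fun ω => hdb _
  have hFi : ∀ a b, IntervalIntegrable F volume a b := fun a b =>
    (intervalIntegrable_const (c := (1 : ℝ))).mono_fun hFm.aestronglyMeasurable
      (ae_of_all _ fun t => by simpa using hFb t)
  set c := ∫ ω, steinDer S z (V ω + X i ω) ∂P with hc
  have hcF : c = ∫ ω, F (X i ω) ∂P :=
    integral_comp_of_indepFun hXm hVm hind (φ := fun x v => steinDer S z (v + x))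
      (hdm.comp (measurable_snd.add measurable_fst))
      (integrable_of_abs_le (hdm.comp (hVm.add hXm)) fun ω => hdb _)
  set m := ∫ ω, |X i ω| ∂P with hm
  have hFX : Integrable (fun ω => F (X i ω)) P :=
    integrable_of_abs_le (hFm.comp hXm) fun ω => hFb _
  have hFc : ∀ t, |t| ≤ 1 → |F t - c| ≤ A * (|t| + m) + C := by
    intro t ht
    have e1 : F t - c = ∫ ω, (F t - F (X i ω)) ∂P := by
      rw [integral_sub (integrable_const _) hFX, ← hcF]; simp
    have hi : Integrable (fun ω => |t| + |X i ω|) P :=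
      (integrable_const _).add (h.integrable i).abs
    have e2 : ∫ ω, (A * (|t| + |X i ω|) + C) ∂P = A * (|t| + m) + C := by
      rw [integral_add (hi.const_mul _) (integrable_const _), integral_const_mul,
        integral_add (integrable_const _) (h.integrable i).abs]
      simp [hm]
    rw [e1, ← e2]
    refine abs_integral_le_of_abs_le ((hi.const_mul _).add (integrable_const _)) fun ω => ?_
    exact hF t (X i ω) ht (h.bdd i ω)
  have hinner : ∀ x, |x| ≤ 1 →
      |x * ((∫ ω, (f (V ω + x) - f (V ω)) ∂P) - c * x)|
        ≤ A * (|x| ^ 3 / 2 + m * x ^ 2) + C * x ^ 2 := by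
    intro x hx
    have e1 : ∫ ω, (f (V ω + x) - f (V ω)) ∂P = ∫ t in (0 : ℝ)..x, F t := by
      simp_rw [hf, ← integral_steinDer hS hz]
      refine (intervalIntegral_integral_swap ?_).symm
      have : IsFiniteMeasure ((volume : Measure ℝ).restrict (Set.uIoc 0 x)) :=
        ⟨by rw [Measure.restrict_apply_univ, Set.uIoc]; exact measure_Ioc_lt_top⟩
      refine Integrable.of_bound (C := 1) ?_ (ae_of_all _ fun p => hdb _)
      exact (hdm.comp ((hVm.comp measurable_snd).add measurable_fst)).aestronglyMeasurable
    have e2 : (∫ t in (0 : ℝ)..x, F t) - c * x = ∫ t in (0 : ℝ)..x, (F t - c) := by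
      rw [intervalIntegral.integral_sub (hFi 0 x) intervalIntegrable_const]
      simp [mul_comm]
    have e3 : |∫ t in (0 : ℝ)..x, (F t - c)| ≤ |∫ t in (0 : ℝ)..x, (A * |t| + (A * m + C))| := by
      rw [← Real.norm_eq_abs]
      refine intervalIntegral.norm_integral_le_abs_of_norm_le ?_ ?_
      · refine (ae_restrict_mem measurableSet_uIoc).mono fun t ht => ?_
        have ht1 : |t| ≤ 1 := by
          rw [Set.mem_uIoc] at ht
          rw [abs_le] at hx ⊢
          rcases ht with ht | ht <;> constructor <;> linarith
        have := hFc t ht1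
        rw [Real.norm_eq_abs]
        linarith
      · exact ((continuous_const.mul continuous_abs).add continuous_const).intervalIntegrable _ _
    have e4 : ∫ t in (0 : ℝ)..x, (A * |t| + (A * m + C)) = x * (A * (|x| / 2 + m) + C) := by
      have hi : IntervalIntegrable (fun t : ℝ => A * |t|) volume 0 x :=
        (continuous_const.mul continuous_abs).intervalIntegrable _ _
      rw [intervalIntegral.integral_add hi intervalIntegrable_const,
        intervalIntegral.integral_const_mul, intervalIntegral_abs_zero]
      simp
      ring
    have hK : 0 ≤ A * (|x| / 2 + m) + C := by
      have h0 := hFc 0 (by simp)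
      have h1 := abs_nonneg (F 0 - c)
      have h2 : 0 ≤ A * |x| := by positivity
      simp only [abs_zero, zero_add] at h0
      linarith
    rw [e1, e2, abs_mul]
    rw [e4, abs_mul, abs_of_nonneg hK] at e3
    calc |x| * |∫ t in (0 : ℝ)..x, (F t - c)| ≤ |x| * (|x| * (A * (|x| / 2 + m) + C)) := by gcongr
      _ = A * (|x| ^ 3 / 2 + m * |x| ^ 2) + C * |x| ^ 2 := by ring
      _ = _ := by rw [sq_abs]
  have hXf1 : Integrable (fun ω => X i ω * f (V ω + X i ω)) P :=
    integrable_of_abs_le (hXm.mul (hfm.comp (hVm.add hXm))) (C := 1 * 1.26) fun ω => by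
      rw [abs_mul]; exact mul_le_mul (h.bdd i ω) (hfb _) (abs_nonneg _) zero_le_one
  have hXf2 : Integrable (fun ω => X i ω * f (V ω)) P :=
    integrable_of_abs_le (hXm.mul (hfm.comp hVm)) (C := 1 * 1.26) fun ω => by
      rw [abs_mul]; exact mul_le_mul (h.bdd i ω) (hfb _) (abs_nonneg _) zero_le_one
  have hX2 := h.integrable_pow i 2
  have hX3 := h.integrable_abs_pow i 3
  have hprod : (∫ ω, X i ω ∂P) * (∫ ω, f (V ω) ∂P) = ∫ ω, X i ω * f (V ω) ∂P :=
    (h.integral_mul_comp_psum (Finset.notMem_erase i _) hfm).symm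
  have hφi : Integrable (fun ω => X i ω * (f (V ω + X i ω) - f (V ω) - c * X i ω)) P := by
    refine ((hXf1.sub hXf2).sub (hX2.const_mul c)).congr (ae_of_all _ fun ω => ?_)
    simp only [Pi.sub_apply]; ring
  have hlhs : (∫ ω, X i ω * f (V ω + X i ω) ∂P) - (∫ ω, X i ω ∂P) * (∫ ω, f (V ω) ∂P)
      - c * ∫ ω, X i ω ^ 2 ∂P
      = ∫ ω, X i ω * ((∫ ω', (f (V ω' + X i ω) - f (V ω')) ∂P) - c * X i ω) ∂P := by
    have e1 : (∫ ω, X i ω * f (V ω + X i ω) ∂P) - (∫ ω, X i ω ∂P) * (∫ ω, f (V ω) ∂P)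
        - c * ∫ ω, X i ω ^ 2 ∂P
        = ∫ ω, X i ω * (f (V ω + X i ω) - f (V ω) - c * X i ω) ∂P := by
      have hd : Integrable (fun ω => X i ω * f (V ω + X i ω) - X i ω * f (V ω)) P :=
        hXf1.sub hXf2
      rw [hprod, ← integral_const_mul, ← integral_sub hXf1 hXf2,
        ← integral_sub hd (hX2.const_mul c)]
      congr 1 with ω
      ring
    rw [e1, integral_comp_of_indepFun hXm hVm hind
      (φ := fun x v => x * (f (v + x) - f v - c * x)) ?_ hφi]
    · congr 1 with ω
      rw [integral_const_mul, integral_sub _ (integrable_const _)]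
      · simp
      · exact integrable_of_abs_le ((hfm.comp (hVm.add_const _)).sub (hfm.comp hVm))
          (C := 1.26 + 1.26) fun ω' => (abs_sub _ _).trans (add_le_add (hfb _) (hfb _))
    · exact measurable_fst.mul (((hfm.comp (measurable_snd.add measurable_fst)).sub
        (hfm.comp measurable_snd)).sub (measurable_fst.const_mul c))
  rw [hlhs]
  have hX23 : Integrable (fun ω => |X i ω| ^ 3 / 2 + m * X i ω ^ 2) P :=
    (hX3.div_const 2).add (hX2.const_mul m)
  have hbound : |∫ ω, X i ω * ((∫ ω', (f (V ω' + X i ω) - f (V ω')) ∂P) - c * X i ω) ∂P|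
      ≤ ∫ ω, (A * (|X i ω| ^ 3 / 2 + m * X i ω ^ 2) + C * X i ω ^ 2) ∂P :=
    abs_integral_le_of_abs_le ((hX23.const_mul A).add (hX2.const_mul C))
      fun ω => hinner _ (h.bdd i ω)
  refine hbound.trans ?_
  rw [integral_add (hX23.const_mul A) (hX2.const_mul C),
    integral_const_mul, integral_const_mul, integral_add (hX3.div_const 2) (hX2.const_mul m),
    integral_div, integral_const_mul]
  have := mul_le_mul_of_nonneg_left (h.integral_abs_mul_sq_le i) hA
  rw [← hm] at this
  linarith

/-- Stein's method for a left half-line, with the smoothness of the leave-one-out expectations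
as a hypothesis. -/
theorem abs_measureReal_sub_gaussLower_le [DecidableEq ι] (h : TruncatedSummands P X b₂ b₃)
    {S : Set ℝ} {z : ℝ} (hS : IsLeftRay S z) (hz : 0 ≤ z) {A B B' C : ℝ} (hA : 0 ≤ A)
    (hB0 : 0 ≤ B) (hC : 0 ≤ C)
    (hF : ∀ i s t, |s| ≤ 1 → |t| ≤ 1 →
      |(∫ ω, steinDer S z (psum X (Finset.univ.erase i) ω + s) ∂P)
        - ∫ ω, steinDer S z (psum X (Finset.univ.erase i) ω + t) ∂P| ≤ A * (|s| + |t|) + C)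
    (hB : ∀ i, ∫ ω, steinSol z (psum X (Finset.univ.erase i) ω) ∂P ≤ B)
    (hB' : |∫ ω, steinDer S z (psum X Finset.univ ω) ∂P| ≤ B') :
    |P.real {ω | psum X Finset.univ ω ∈ S} - gaussLower z|
      ≤ 3 / 2 * A * b₃ + C + (B + B') * b₂ := by
  set W := psum X Finset.univ with hW
  have hWm : Measurable W := h.measurable_psum _
  have hfm : Measurable (steinSol z) := (continuous_steinSol z).measurable
  have hfb : ∀ w, |steinSol z w| ≤ 1.26 := fun w => by
    rw [abs_of_pos (steinSol_pos z w)]; exact steinSol_le_of_nonneg hz w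
  set c := ∫ ω, steinDer S z (W ω) ∂P with hc
  have hSm : MeasurableSet {ω | W ω ∈ S} := hWm hS.measurableSet
  have hWf : Integrable (fun ω => W ω * steinSol z (W ω)) P :=
    integrable_of_abs_le (hWm.mul (hfm.comp hWm))
      (C := (Finset.univ : Finset ι).card * 1.26) fun ω => by
        rw [abs_mul]
        exact mul_le_mul (h.abs_psum_le _ ω) (hfb _) (abs_nonneg _) (Nat.cast_nonneg _)
  have hXf : ∀ i, Integrable (fun ω => X i ω * steinSol z (W ω)) P := fun i =>
    integrable_of_abs_le ((h.meas i).mul (hfm.comp hWm)) (C := 1 * 1.26) fun ω => by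
      rw [abs_mul]; exact mul_le_mul (h.bdd i ω) (hfb _) (abs_nonneg _) zero_le_one
  have e1 : c = (∫ ω, W ω * steinSol z (W ω) ∂P) + P.real {ω | W ω ∈ S} - gaussLower z := by
    have hind : Integrable (fun ω => S.indicator (1 : ℝ → ℝ) (W ω)) P :=
      ((integrable_const (1 : ℝ)).indicator hSm).congr (ae_of_all _ fun ω => by
        simp [Set.indicator])
    have : ∫ ω, S.indicator (1 : ℝ → ℝ) (W ω) ∂P = P.real {ω | W ω ∈ S} := by
      rw [← integral_indicator_one hSm]
      rfl
    have hadd : Integrable (fun ω => W ω * steinSol z (W ω) + S.indicator (1 : ℝ → ℝ) (W ω)) P :=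
      hWf.add hind
    rw [← this, ← integral_add hWf hind]
    simp only [hc, steinDer]
    rw [integral_sub hadd (integrable_const _)]
    simp
  have e2 : ∫ ω, W ω * steinSol z (W ω) ∂P = ∑ i, ∫ ω, X i ω * steinSol z (W ω) ∂P := by
    rw [← integral_finsetSum _ fun i _ => hXf i]
    congr 1 with ω
    conv_lhs => rw [hW, psum, Finset.sum_mul]
    rfl
  set T : ι → ℝ := fun i => (∫ ω, X i ω * steinSol z (W ω) ∂P)
      - (∫ ω, X i ω ∂P) * (∫ ω, steinSol z (psum X (Finset.univ.erase i) ω) ∂P)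
      - c * ∫ ω, X i ω ^ 2 ∂P with hT
  -- The coefficients of `c` in the summands total `1 - b₂`, so only `b₂ * c` survives from `E
  -- f'(W)`.
  have e3 : P.real {ω | W ω ∈ S} - gaussLower z
      = b₂ * c - ∑ i, T i - ∑ i, (∫ ω, X i ω ∂P)
        * (∫ ω, steinSol z (psum X (Finset.univ.erase i) ω) ∂P) := by
    simp only [hT, Finset.sum_sub_distrib, ← Finset.mul_sum, h.second, ← e2]
    linarith
  have hT' : |∑ i, T i| ≤ 3 / 2 * A * b₃ + C * (1 - b₂) := by
    rw [← h.second, ← h.third, Finset.mul_sum, Finset.mul_sum, ← Finset.sum_add_distrib]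
    exact (Finset.abs_sum_le_sum_abs _ _).trans
      (Finset.sum_le_sum fun i _ => h.stein_summand hS hz i (hF i) hA)
  have hm : |∑ i, (∫ ω, X i ω ∂P) * (∫ ω, steinSol z (psum X (Finset.univ.erase i) ω) ∂P)|
      ≤ b₂ * B := by
    calc _ ≤ ∑ i, |∫ ω, X i ω ∂P| * B := by
          refine (Finset.abs_sum_le_sum_abs _ _).trans (Finset.sum_le_sum fun i _ => ?_)
          rw [abs_mul]
          refine mul_le_mul_of_nonneg_left ?_ (abs_nonneg _)
          rw [abs_of_nonneg (integral_nonneg fun _ => (steinSol_pos _ _).le)]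
          exact hB i
      _ = (∑ i, |∫ ω, X i ω ∂P|) * B := by rw [Finset.sum_mul]
      _ ≤ b₂ * B := by gcongr; exact h.mean
  rw [e3]
  have hb2 := h.b₂_nonneg
  have h1 : |b₂ * c| ≤ b₂ * B' := by
    rw [abs_mul, abs_of_nonneg hb2]; gcongr
  have h2 : C * (1 - b₂) ≤ C := by nlinarith
  have h3 := abs_sub (b₂ * c - ∑ i, T i) (∑ i, (∫ ω, X i ω ∂P)
        * (∫ ω, steinSol z (psum X (Finset.univ.erase i) ω) ∂P))
  have h4 := abs_sub (b₂ * c) (∑ i, T i)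
  linarith

end TruncatedSummands

end SteinBound

/-! ### Increments of the expected derivative, and the bounds for small and moderate `z` -/

section Regimes

variable {Ω ι : Type*} [MeasurableSpace Ω] [Fintype ι] {P : Measure Ω} [IsProbabilityMeasure P]
  {X : ι → Ω → ℝ} {b₂ b₃ : ℝ}

namespace TruncatedSummands

lemma integrable_mul_steinSol (h : TruncatedSummands P X b₂ b₃) {z : ℝ} (hz : 0 ≤ z)
    (s : Finset ι) (t : ℝ) :
    Integrable (fun ω => (psum X s ω + t) * steinSol z (psum X s ω + t)) P := by
  refine integrable_of_abs_le
    ((continuous_mul_steinSol z).measurable.comp ((h.measurable_psum s).add_const t))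
    (C := (s.card + |t|) * 1.26) fun ω => ?_
  rw [abs_mul, abs_of_pos (steinSol_pos _ _)]
  exact mul_le_mul ((abs_add_le _ _).trans (by gcongr; exact h.abs_psum_le s ω))
    (steinSol_le_of_nonneg hz _) (steinSol_pos _ _).le (by positivity)

/-- Increments of the expected derivative split into a smooth part and a concentration part. -/
lemma abs_integral_steinDer_sub_le (h : TruncatedSummands P X b₂ b₃) {S : Set ℝ} {z : ℝ}
    (hS : IsLeftRay S z) (hz : 0 ≤ z) (u : Finset ι) {A C : ℝ}
    (hF : ∀ s t, |s| ≤ 1 → |t| ≤ 1 → s ≤ t →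
      |∫ ω, ((psum X u ω + t) * steinSol z (psum X u ω + t)
          - (psum X u ω + s) * steinSol z (psum X u ω + s)) ∂P|
        + P.real {ω | psum X u ω ∈ Set.Icc (z - t) (z - s)} ≤ A * (|s| + |t|) + C)
    {s t : ℝ} (hs : |s| ≤ 1) (ht : |t| ≤ 1) :
    |(∫ ω, steinDer S z (psum X u ω + s) ∂P) - ∫ ω, steinDer S z (psum X u ω + t) ∂P|
      ≤ A * (|s| + |t|) + C := by
  wlog hst : s ≤ t generalizing s t
  · rw [abs_sub_comm, add_comm |s|]
    exact this ht hs (le_of_not_ge hst)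
  refine le_trans ?_ (hF s t hs ht hst)
  have hVm := h.measurable_psum u
  have hint : ∀ r, Integrable (fun ω => steinDer S z (psum X u ω + r)) P := fun r =>
    integrable_of_abs_le ((measurable_steinDer hS).comp (hVm.add_const r))
      fun ω => abs_steinDer_le_one hS hz _
  set I := {ω | psum X u ω ∈ Set.Icc (z - t) (z - s)} with hI
  have hIm : MeasurableSet I := hVm measurableSet_Icc
  set G : Ω → ℝ := fun ω => (psum X u ω + t) * steinSol z (psum X u ω + t)
          - (psum X u ω + s) * steinSol z (psum X u ω + s) with hG
  have hGi : Integrable G P :=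
    (h.integrable_mul_steinSol hz u t).sub (h.integrable_mul_steinSol hz u s)
  have hsplit : (∫ ω, steinDer S z (psum X u ω + s) ∂P) - ∫ ω, steinDer S z (psum X u ω + t) ∂P
      = (∫ ω, (steinDer S z (psum X u ω + s) - steinDer S z (psum X u ω + t) + G ω) ∂P)
        - ∫ ω, G ω ∂P := by
    have hd : Integrable
        (fun ω => steinDer S z (psum X u ω + s) - steinDer S z (psum X u ω + t)) P :=
      (hint s).sub (hint t)
    rw [integral_add hd hGi, integral_sub (hint s) (hint t)]
    ring
  have hrest : |∫ ω, (steinDer S z (psum X u ω + s) - steinDer S z (psum X u ω + t) + G ω) ∂P|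
      ≤ P.real I := by
    rw [← integral_indicator_one hIm]
    refine abs_integral_le_of_abs_le ((integrable_const (1 : ℝ)).indicator hIm) fun ω => ?_
    -- Adding back the increment of `w * f w` leaves a difference of two indicators, which vanishes
    -- unless `z` separates the two shifted points.
    have e : steinDer S z (psum X u ω + s) - steinDer S z (psum X u ω + t) + G ω
        = S.indicator 1 (psum X u ω + s) - S.indicator 1 (psum X u ω + t) := by
      simp only [steinDer, hG]; ring
    rw [e]
    by_cases hω : ω ∈ I
    · rw [Set.indicator_of_mem hω]
      by_cases h1 : psum X u ω + s ∈ S <;> by_cases h2 : psum X u ω + t ∈ S <;> simp [h1, h2]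
    · rw [Set.indicator_of_notMem hω]
      have hiff : psum X u ω + s ∈ S ↔ psum X u ω + t ∈ S := by
        constructor
        · intro h1
          by_contra h2
          exact hω ⟨by linarith [hS.le_of_notMem h2], by linarith [hS.le_of_mem h1]⟩
        · intro h1
          by_contra h2
          have e1 := hS.le_of_notMem h2
          have e2 := hS.le_of_mem h1
          have e3 : s = t := by linarith
          rw [e3] at h2
          exact h2 h1
      by_cases h1 : psum X u ω + s ∈ S
      · simp [h1, hiff.1 h1]
      · simp [h1, mt hiff.2 h1]
  rw [hsplit]
  refine (abs_sub _ _).trans ?_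
  linarith

lemma sub_le_abs_add_abs (s t : ℝ) : t - s ≤ |s| + |t| := by
  linarith [neg_abs_le s, le_abs_self t]

/-- The bound for small `z`. -/
theorem abs_sub_gaussLower_le_of_small [DecidableEq ι] (h : TruncatedSummands P X b₂ b₃)
    (hb0 : 0 < b₂ + b₃) (hb : b₂ + b₃ ≤ 2 / 37) {S : Set ℝ} {z : ℝ} (hS : IsLeftRay S z)
    (hz : 0 ≤ z) :
    |P.real {ω | psum X Finset.univ ω ∈ S} - gaussLower z| ≤ 6.13 * b₃ + 3.7 * b₂ := by
  have hb2 := h.b₂_nonneg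
  have hb3 := h.b₃_nonneg
  -- `A = 2.26 + 0.865`: the increment of `w * f w` costs `E|V| + 1.26 ≤ 2.26`, and concentration
  -- supplies the slope `0.865` and the constant term `C`.
  have := h.abs_measureReal_sub_gaussLower_le hS hz (A := 3.125) (B := 1.26) (B' := 1)
    (C := 1.44 * (b₂ + b₃)) (by norm_num) (by norm_num) (by positivity) ?_ ?_ ?_
  · refine this.trans ?_
    linarith
  · intro i s t hs ht
    refine h.abs_integral_steinDer_sub_le hS hz _ ?_ hs ht
    intro s t hs ht hst
    set V := psum X (Finset.univ.erase i)
    have h1 := h.concentration_uniform hb0 hb i (show z - t ≤ z - s by linarith)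
    have h2 : |∫ ω, ((V ω + t) * steinSol z (V ω + t) - (V ω + s) * steinSol z (V ω + s)) ∂P|
        ≤ 2.26 * (|s| + |t|) := by
      calc _ ≤ ∫ ω, (|V ω| + 1.26) * (|s| + |t|) ∂P := by
            refine abs_integral_le_of_abs_le ((((h.integrable_psum _).abs).add
              (integrable_const _)).mul_const _) fun ω => ?_
            -- Only the Lipschitz constant `1` and the sup bound `1.26` of `f` enter here, hence no
            -- decay in `z`.
            have e : (V ω + t) * steinSol z (V ω + t) - (V ω + s) * steinSol z (V ω + s)
                = V ω * (steinSol z (V ω + t) - steinSol z (V ω + s))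
                  + (t * steinSol z (V ω + t) - s * steinSol z (V ω + s)) := by ring
            have e1 : |steinSol z (V ω + t) - steinSol z (V ω + s)| ≤ |s| + |t| := by
              refine (abs_steinSol_sub_le hz _ _).trans ?_
              rw [show V ω + t - (V ω + s) = t - s by ring, abs_of_nonneg (by linarith)]
              exact sub_le_abs_add_abs s t
            have e2 : ∀ r v, |r * steinSol z v| ≤ 1.26 * |r| := fun r v => by
              rw [abs_mul, abs_of_pos (steinSol_pos _ _), mul_comm]
              gcongr
              exact steinSol_le_of_nonneg hz v
            rw [e]
            refine (abs_add_le _ _).trans ?_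
            have e3 := abs_sub (t * steinSol z (V ω + t)) (s * steinSol z (V ω + s))
            have e4 := e2 t (V ω + t)
            have e5 := e2 s (V ω + s)
            have e6 : |V ω * (steinSol z (V ω + t) - steinSol z (V ω + s))|
                ≤ |V ω| * (|s| + |t|) := by
              rw [abs_mul]; gcongr
            linarith
        _ = ((∫ ω, |V ω| ∂P) + 1.26) * (|s| + |t|) := by
            rw [integral_mul_const, integral_add (h.integrable_psum _).abs (integrable_const _)]
            simp [V]
        _ ≤ (1 + 1.26) * (|s| + |t|) := by gcongr; exact h.integral_abs_psum_le _
        _ = _ := by norm_num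
    have h3 := sub_le_abs_add_abs s t
    linarith
  · intro i
    exact (le_abs_self _).trans (abs_integral_le_const fun ω => by
      rw [abs_of_pos (steinSol_pos _ _)]; exact steinSol_le_of_nonneg hz _)
  · exact abs_integral_le_const fun ω => abs_steinDer_le_one hS hz _

lemma integral_psum_mul_le (h : TruncatedSummands P X b₂ b₃) (s : Finset ι) (r : ℝ) :
    (∫ ω, psum X s ω ∂P) * r ≤ b₂ * |r| := by
  refine (le_abs_self _).trans ?_
  rw [abs_mul]
  exact mul_le_mul_of_nonneg_right (h.abs_integral_psum_le s) (abs_nonneg _)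

/-- The bound for moderate `z`, in terms of `E = exp (-z ^ 2 / 2)`. -/
theorem abs_sub_gaussLower_le_of_moderate [DecidableEq ι] (h : TruncatedSummands P X b₂ b₃)
    (hb0 : 0 < b₂ + b₃) (hb : b₂ + b₃ ≤ 2 / 37) {S : Set ℝ} {z : ℝ} (hS : IsLeftRay S z)
    (hz : 0 < z) :
    |P.real {ω | psum X Finset.univ ω ∈ S} - gaussLower z|
      ≤ (3 / 2 * (Real.exp (-z ^ 2 / 2) / z
          + 1.3364 * ((1 + z ^ 2 - Real.exp (-z ^ 2 / 2)) / z ^ 3)) + 2.7375) * b₃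
        + (1 / z + 2.44) * b₂ := by
  have hb2 := h.b₂_nonneg
  have hb3 := h.b₃_nonneg
  set c₀ := Real.exp (-z ^ 2 / 2) / z with hc₀
  set c := (1 + z ^ 2 - Real.exp (-z ^ 2 / 2)) / z ^ 3 with hc
  have hE1 : Real.exp (-z ^ 2 / 2) ≤ 1 := Real.exp_le_one_iff.2 (by nlinarith [sq_nonneg z])
  have hc₀0 : 0 ≤ c₀ := by positivity
  have hc0 : 0 ≤ c := by
    have : 0 ≤ 1 + z ^ 2 - Real.exp (-z ^ 2 / 2) := by nlinarith [sq_nonneg z]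
    positivity
  -- `1.3364` rounds up `4 / 3 + (2 / 37)²`, and `2.7375 = 3 / 2 * 0.865 + 1.44` gathers the
  -- concentration terms.
  have := h.abs_measureReal_sub_gaussLower_le hS hz.le (A := c₀ + 1.3364 * c + 0.865)
    (B := 1 / z) (B' := 1) (C := 1.44 * (b₂ + b₃)) (by positivity) (by positivity)
    (by positivity) ?_ ?_ ?_
  · refine this.trans ?_
    linarith
  · intro i s t hs ht
    refine h.abs_integral_steinDer_sub_le hS hz.le _ ?_ hs ht
    intro s t hs ht hst
    set V := psum X (Finset.univ.erase i) with hV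
    have h1 := h.concentration_uniform hb0 hb i (show z - t ≤ z - s by linarith)
    have hst' := sub_le_abs_add_abs s t
    have h2 : |∫ ω, ((V ω + t) * steinSol z (V ω + t) - (V ω + s) * steinSol z (V ω + s)) ∂P|
        ≤ (c₀ + 1.3364 * c) * (|s| + |t|) := by
      have hV1 := h.integrable_psum (Finset.univ.erase i)
      have hV2 := h.integrable_psum_pow (Finset.univ.erase i) 2
      rw [← hV] at hV1 hV2
      set r := c₀ * (t - s) + c / 3 * (t ^ 3 - s ^ 3)
      have hi1 : Integrable (fun ω => c * (t - s) * V ω ^ 2 + c * (t ^ 2 - s ^ 2) * V ω) P :=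
        (hV2.const_mul _).add (hV1.const_mul _)
      have hQ : ∀ w, HasDerivAt (fun w => c₀ * w + c / 3 * w ^ 3) (c₀ + c * w ^ 2) w := fun w =>
        (((hasDerivAt_id w).const_mul c₀).add ((hasDerivAt_pow 3 w).const_mul (c / 3))).congr_deriv
          (by norm_num; ring)
      calc _ ≤ ∫ ω, ((c * (t - s) * V ω ^ 2 + c * (t ^ 2 - s ^ 2) * V ω) + r) ∂P := by
            refine abs_integral_le_of_abs_le (hi1.add (integrable_const _)) fun ω => ?_
            have hle : V ω + s ≤ V ω + t := by linarith
            have e1 := mul_steinSol_sub_le hQ (fun w => steinMulDer_le_quadratic hz w) hle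
            have e2 := monotone_mul_steinSol z hle
            simp only at e2
            rw [abs_of_nonneg (by linarith)]
            refine e1.trans (le_of_eq ?_)
            simp only [r]
            ring
        _ = c * (t - s) * (∫ ω, V ω ^ 2 ∂P) + c * ((∫ ω, V ω ∂P) * (t ^ 2 - s ^ 2)) + r := by
            rw [integral_add hi1 (integrable_const _), integral_add (hV2.const_mul _)
              (hV1.const_mul _), integral_const_mul, integral_const_mul]
            simp
            ring
        _ ≤ c * (|s| + |t|) * (1 - b₂ + b₂ ^ 2) + c * (b₂ * (|s| + |t|))
            + (c₀ * (|s| + |t|) + c / 3 * (|s| + |t|)) := by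
            have hs3 : |s| ^ 3 ≤ |s| := by
              calc |s| ^ 3 ≤ |s| ^ 1 := pow_le_pow_of_le_one (abs_nonneg _) hs (by norm_num)
                _ = |s| := pow_one _
            have ht3 : |t| ^ 3 ≤ |t| := by
              calc |t| ^ 3 ≤ |t| ^ 1 := pow_le_pow_of_le_one (abs_nonneg _) ht (by norm_num)
                _ = |t| := pow_one _
            have hs2 : |s| ^ 2 ≤ |s| := by
              calc |s| ^ 2 ≤ |s| ^ 1 := pow_le_pow_of_le_one (abs_nonneg _) hs (by norm_num)
                _ = |s| := pow_one _
            have ht2 : |t| ^ 2 ≤ |t| := by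
              calc |t| ^ 2 ≤ |t| ^ 1 := pow_le_pow_of_le_one (abs_nonneg _) ht (by norm_num)
                _ = |t| := pow_one _
            have e3 : t ^ 3 - s ^ 3 ≤ |s| + |t| := by
              have e4 := sub_le_abs_add_abs (s ^ 3) (t ^ 3)
              rw [abs_pow, abs_pow] at e4
              linarith
            have e2 : |t ^ 2 - s ^ 2| ≤ |s| + |t| := by
              have e4 := abs_sub (t ^ 2) (s ^ 2)
              rw [abs_pow, abs_pow] at e4
              linarith
            have e5 := h.integral_psum_mul_le (Finset.univ.erase i) (t ^ 2 - s ^ 2)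
            have e6 : (∫ ω, V ω ∂P) * (t ^ 2 - s ^ 2) ≤ b₂ * (|s| + |t|) :=
              e5.trans (by gcongr)
            have e7 := h.integral_psum_sq_le (Finset.univ.erase i)
            have e8 : 0 ≤ ∫ ω, V ω ^ 2 ∂P := integral_nonneg fun _ => sq_nonneg _
            simp only [r]
            gcongr
        -- The mean contributes `b₂`, which cancels the `-b₂` of the second moment; the extra `1 /
        -- 3` comes from the cubes of `s` and `t`.
        _ = (c₀ + (4 / 3 + b₂ ^ 2) * c) * (|s| + |t|) := by ring
        _ ≤ _ := by
            gcongr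
            nlinarith
    linarith
  · intro i
    exact (le_abs_self _).trans (abs_integral_le_const fun ω => by
      rw [abs_of_pos (steinSol_pos _ _)]; exact steinSol_le_inv hz _)
  · exact abs_integral_le_const fun ω => abs_steinDer_le_one hS hz.le _

/-- With `z = 2 - x`, the last factor is a Taylor lower bound of `exp (z² / 2)`; hence `exp (-z² /
2) ≤ 0.17 + 0.37 x` for `z` between `1.45` and `2`. -/
lemma one_le_linear_mul_exp_poly {x : ℝ} (hx0 : 0 ≤ x) (hx1 : x ≤ 0.55) :
    1 ≤ (0.17 + 0.37 * x) * (1 + (2 - x) ^ 2 / 2 + (2 - x) ^ 4 / 8 + (2 - x) ^ 6 / 48) := by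
  have h6 : 0 ≤ x^6 * (1 - x) := mul_nonneg (by positivity) (by linarith)
  have h4 : 0 ≤ x^4 * (0.55 - x) := mul_nonneg (by positivity) (by linarith)
  have h3 : 0 ≤ x^3 * (0.55 - x) := mul_nonneg (by positivity) (by linarith)
  have h2 : 0 ≤ x^2 * (0.55 - x) := mul_nonneg (by positivity) (by linarith)
  have h1 : 0 ≤ x * (0.55 - x) := mul_nonneg (by positivity) (by linarith)
  have h5 : 0 ≤ x^5 := by positivity
  nlinarith [sq_nonneg (x - 0.55), mul_nonneg hx0 (sq_nonneg (x - 0.55)),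
    mul_nonneg (pow_nonneg hx0 2) (sq_nonneg (x - 0.55)),
    mul_nonneg (pow_nonneg hx0 3) (sq_nonneg (x - 0.55))]

/-- This is where `37` is nearly used up: at `z = 2` the left side is about `4.06`, against `37 /
9`, about `4.11`. -/
lemma moderate_constant_le {z : ℝ} (hz : 1.45 ≤ z) (hz2 : z ≤ 2) :
    3 / 2 * (Real.exp (-z ^ 2 / 2) / z
        + 1.3364 * ((1 + z ^ 2 - Real.exp (-z ^ 2 / 2)) / z ^ 3)) + 2.7375
      ≤ 37 * ((1 + z) ^ 2)⁻¹ := by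
  have hz0 : 0 < z := by linarith
  set E := Real.exp (-z ^ 2 / 2) with hE
  have hE0 : 0 < E := Real.exp_pos _
  have hEz : E * (1 + z ^ 2 / 2 + z ^ 4 / 8 + z ^ 6 / 48) ≤ 1 := by
    have h1 := Real.sum_le_exp_of_nonneg (show 0 ≤ z ^ 2 / 2 by positivity) 4
    simp only [Finset.sum_range_succ, Finset.sum_range_zero, Nat.factorial] at h1
    norm_num at h1
    have h2 := exp_mul_exp_neg_sq_half z
    calc E * (1 + z ^ 2 / 2 + z ^ 4 / 8 + z ^ 6 / 48) ≤ E * Real.exp (z ^ 2 / 2) := by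
          gcongr
          refine le_trans (le_of_eq ?_) h1
          ring
      _ = 1 := by rw [mul_comm]; exact h2
  obtain ⟨x, rfl⟩ : ∃ x, z = 2 - x := ⟨2 - z, by ring⟩
  have hx0 : 0 ≤ x := by linarith
  have hx1 : x ≤ 0.55 := by linarith
  have hE1 : E ≤ 0.17 + 0.37 * x := by
    set p := 1 + (2 - x) ^ 2 / 2 + (2 - x) ^ 4 / 8 + (2 - x) ^ 6 / 48 with hp
    have hp0 : 0 < p := by positivity
    exact le_of_mul_le_mul_right (hEz.trans (one_le_linear_mul_exp_poly hx0 hx1)) hp0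
  have hz0 : 0 < 2 - x := by linarith
  have hw0 : 0 < 1 + (2 - x) := by linarith
  -- After clearing denominators the coefficient of `E` is positive on this range, so an upper bound
  -- on `E` suffices; `2.0046 = 1.5 * 1.3364`.
  have hE' : E * (1.5 * (2 - x) ^ 2 - 2.0046) ≤ (0.17 + 0.37 * x) * (1.5 * (2 - x) ^ 2 - 2.0046) := by
    gcongr
    nlinarith
  have key : (0.17 + 0.37 * x) * (1.5 * (2 - x) ^ 2 - 2.0046) * (1 + (2 - x)) ^ 2
      + 2.0046 * (1 + (2 - x) ^ 2) * (1 + (2 - x)) ^ 2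
      + 2.7375 * (2 - x) ^ 3 * (1 + (2 - x)) ^ 2 ≤ 37 * (2 - x) ^ 3 := by
    have h4 : 0 ≤ x ^ 4 * (0.55 - x) := mul_nonneg (by positivity) (by linarith)
    have h3 : 0 ≤ x ^ 3 * (0.55 - x) := mul_nonneg (by positivity) (by linarith)
    have h2 : 0 ≤ x ^ 2 * (0.55 - x) := mul_nonneg (by positivity) (by linarith)
    have h1 : 0 ≤ x * (0.55 - x) := mul_nonneg (by positivity) (by linarith)
    have h5 : 0 ≤ x ^ 5 := by positivity
    nlinarith [mul_nonneg hx0 (sq_nonneg (x - 0.55)),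
      mul_nonneg (pow_nonneg hx0 2) (sq_nonneg (x - 0.55))]
  have e : 3 / 2 * (E / (2 - x)
        + 1.3364 * ((1 + (2 - x) ^ 2 - E) / (2 - x) ^ 3)) + 2.7375
      = (E * (1.5 * (2 - x) ^ 2 - 2.0046) + 2.0046 * (1 + (2 - x) ^ 2)
        + 2.7375 * (2 - x) ^ 3) / (2 - x) ^ 3 := by
    field_simp
    ring
  rw [e, ← div_eq_mul_inv, div_le_div_iff₀ (by positivity) (by positivity)]
  have := mul_le_mul_of_nonneg_right hE' (sq_nonneg (1 + (2 - x)))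
  linarith

end TruncatedSummands

end Regimes

/-! ### Large `z`: fourth moments and decay of order `z⁻²` -/

section LargeValues

variable {Ω ι : Type*} [MeasurableSpace Ω] [Fintype ι] {P : Measure Ω} [IsProbabilityMeasure P]
  {X : ι → Ω → ℝ} {b₂ b₃ : ℝ}

namespace TruncatedSummands

lemma integral_comp_mul_comp_psum (h : TruncatedSummands P X b₂ b₃) {s : Finset ι} {i : ι}
    (hi : i ∉ s) {f g : ℝ → ℝ} (hf : Measurable f) (hg : Measurable g) :
    ∫ ω, f (X i ω) * g (psum X s ω) ∂P = (∫ ω, f (X i ω) ∂P) * ∫ ω, g (psum X s ω) ∂P :=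
  ((h.indepFun_psum hi).comp hf hg).integral_mul_eq_mul_integral
    (hf.comp (h.meas i)).aestronglyMeasurable (hg.comp (h.measurable_psum s)).aestronglyMeasurable

/-- Fourth central moment of a partial sum. -/
lemma integral_centered_pow_four_le [DecidableEq ι] (h : TruncatedSummands P X b₂ b₃)
    (s : Finset ι) :
    ∫ ω, (psum X s ω - ∫ ω', psum X s ω' ∂P) ^ 4 ∂P
      ≤ 3 * (∑ i ∈ s, ∫ ω, X i ω ^ 2 ∂P) ^ 2 + 4 * ∑ i ∈ s, ∫ ω, X i ω ^ 2 ∂P := by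
  induction s using Finset.induction_on with
  | empty => simp [psum]
  | insert i s hi ih =>
    set M := ∫ ω', psum X s ω' ∂P with hM
    set m := ∫ ω, X i ω ∂P with hm
    set v := ∑ i ∈ s, ∫ ω, X i ω ^ 2 ∂P with hv
    have hm1 : |m| ≤ 1 := abs_integral_le_const (h.bdd i)
    have hins : ∫ ω', psum X (insert i s) ω' ∂P = m + M := by
      rw [h.integral_psum, Finset.sum_insert hi, ← h.integral_psum]
    set Y : Ω → ℝ := fun ω => X i ω - m with hY
    set U : Ω → ℝ := fun ω => psum X s ω - M with hU
    have hYm : Measurable Y := (h.meas i).sub_const _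
    have hUm : Measurable U := (h.measurable_psum s).sub_const _
    have hYb : ∀ ω, |Y ω| ≤ 2 := fun ω => by
      refine (abs_sub _ _).trans ?_
      linarith [h.bdd i ω]
    have hUb : ∀ ω, |U ω| ≤ s.card + |M| := fun ω =>
      (abs_sub _ _).trans (by linarith [h.abs_psum_le s ω])
    have hYU : ∀ k l : ℕ, Integrable (fun ω => Y ω ^ k * U ω ^ l) P := fun k l => by
      refine integrable_of_abs_le ((hYm.pow_const k).mul (hUm.pow_const l))
        (C := 2 ^ k * (s.card + |M|) ^ l) fun ω => ?_
      rw [abs_mul, abs_pow, abs_pow]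
      exact mul_le_mul (pow_le_pow_left₀ (abs_nonneg _) (hYb ω) k)
        (pow_le_pow_left₀ (abs_nonneg _) (hUb ω) l) (by positivity) (by positivity)
    have hYk : ∀ k : ℕ, Integrable (fun ω => Y ω ^ k) P := fun k => by simpa using hYU k 0
    have hUk : ∀ k : ℕ, Integrable (fun ω => U ω ^ k) P := fun k => by simpa using hYU 0 k
    have hprod : ∀ k l : ℕ, ∫ ω, Y ω ^ k * U ω ^ l ∂P
        = (∫ ω, Y ω ^ k ∂P) * ∫ ω, U ω ^ l ∂P := fun k l =>
      h.integral_comp_mul_comp_psum hi (f := fun x => (x - m) ^ k) (g := fun x => (x - M) ^ l)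
        ((measurable_id.sub_const _).pow_const k) ((measurable_id.sub_const _).pow_const l)
    have hY1 : ∫ ω, Y ω ^ 1 ∂P = 0 := by
      simp only [hY, pow_one]
      rw [integral_sub (h.integrable i) (integrable_const _)]
      simp [hm]
    have hU1 : ∫ ω, U ω ^ 1 ∂P = 0 := by
      simp only [hU, pow_one]
      rw [integral_sub (h.integrable_psum s) (integrable_const _)]
      simp [hM]
    have hY2 : ∫ ω, Y ω ^ 2 ∂P ≤ ∫ ω, X i ω ^ 2 ∂P := by
      have := variance_le_expectation_sq (μ := P) (h.meas i).aestronglyMeasurable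
      rw [variance_eq_integral (h.meas i).aemeasurable] at this
      exact this
    have hU2 : ∫ ω, U ω ^ 2 ∂P ≤ v := by
      have e : psum X s = ∑ i ∈ s, X i := by ext ω; simp [psum]
      have h1 : Var[psum X s; P] ≤ v := by
        rw [e, IndepFun.variance_sum (fun i _ => h.memLp i)
          fun i _ j _ hij => h.indep.indepFun hij]
        exact Finset.sum_le_sum fun i _ =>
          variance_le_expectation_sq (h.meas i).aestronglyMeasurable
      rw [variance_eq_integral (h.measurable_psum s).aemeasurable] at h1
      exact h1
    -- In the expansion of `(U + Y)⁴` the terms linear in `Y` or `U` vanish. The cross term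
    -- completes the square in `3 v²`, and `|Y| ≤ 2` sends `E Y⁴` into the linear term.
    have hY4 : ∫ ω, Y ω ^ 4 ∂P ≤ 4 * ∫ ω, Y ω ^ 2 ∂P := by
      rw [← integral_const_mul]
      refine integral_mono (hYk 4) ((hYk 2).const_mul 4) fun ω => ?_
      have : Y ω ^ 2 ≤ 2 ^ 2 := sq_le_sq.2 (by simpa using hYb ω)
      simp only
      nlinarith [sq_nonneg (Y ω)]
    have hexp : ∫ ω, (psum X (insert i s) ω - (m + M)) ^ 4 ∂P
        = (∫ ω, U ω ^ 4 ∂P) + 6 * (∫ ω, Y ω ^ 2 ∂P) * (∫ ω, U ω ^ 2 ∂P) + ∫ ω, Y ω ^ 4 ∂P := by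
      have e : ∀ ω, (psum X (insert i s) ω - (m + M)) ^ 4 = U ω ^ 4 + 4 * (Y ω ^ 1 * U ω ^ 3)
          + 6 * (Y ω ^ 2 * U ω ^ 2) + 4 * (Y ω ^ 3 * U ω ^ 1) + Y ω ^ 4 := fun ω => by
        rw [psum_insert hi]; simp only [hY, hU]; ring
      simp_rw [e]
      have i1 : Integrable (fun ω => U ω ^ 4 + 4 * (Y ω ^ 1 * U ω ^ 3)) P :=
        (hUk 4).add ((hYU 1 3).const_mul 4)
      have i2 : Integrable (fun ω => U ω ^ 4 + 4 * (Y ω ^ 1 * U ω ^ 3)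
          + 6 * (Y ω ^ 2 * U ω ^ 2)) P := i1.add ((hYU 2 2).const_mul 6)
      have i3 : Integrable (fun ω => U ω ^ 4 + 4 * (Y ω ^ 1 * U ω ^ 3)
          + 6 * (Y ω ^ 2 * U ω ^ 2) + 4 * (Y ω ^ 3 * U ω ^ 1)) P := i2.add ((hYU 3 1).const_mul 4)
      rw [integral_add i3 (hYk 4), integral_add i2 ((hYU 3 1).const_mul 4),
        integral_add i1 ((hYU 2 2).const_mul 6), integral_add (hUk 4) ((hYU 1 3).const_mul 4),
        integral_const_mul, integral_const_mul, integral_const_mul, hprod, hprod, hprod, hY1, hU1]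
      ring
    rw [hins, hexp, Finset.sum_insert hi]
    have hY20 : 0 ≤ ∫ ω, Y ω ^ 2 ∂P := integral_nonneg fun _ => sq_nonneg _
    have hU20 : 0 ≤ ∫ ω, U ω ^ 2 ∂P := integral_nonneg fun _ => sq_nonneg _
    have hvi : 0 ≤ ∫ ω, X i ω ^ 2 ∂P := integral_nonneg fun _ => sq_nonneg _
    have hYU2 : (∫ ω, Y ω ^ 2 ∂P) * (∫ ω, U ω ^ 2 ∂P) ≤ (∫ ω, X i ω ^ 2 ∂P) * v :=
      mul_le_mul hY2 hU2 hU20 hvi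
    nlinarith [sq_nonneg (∫ ω, X i ω ^ 2 ∂P)]

/-- The centred moment is at most `3 + 4 = 7` and the mean at most `1` in absolute value, so `(a +
M)⁴ ≤ 8 a⁴ + 8 M⁴` gives `8 * 7 + 8 = 64`. -/
lemma integral_psum_pow_four_le [DecidableEq ι] (h : TruncatedSummands P X b₂ b₃)
    (s : Finset ι) : ∫ ω, psum X s ω ^ 4 ∂P ≤ 64 := by
  set M := ∫ ω', psum X s ω' ∂P with hM
  have hM1 : |M| ≤ 1 := (h.abs_integral_psum_le s).trans h.b₂_le_one
  have hM4 : M ^ 4 ≤ 1 := by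
    have := pow_le_one₀ (n := 4) (abs_nonneg M) hM1
    rwa [← abs_pow, abs_of_nonneg (by positivity)] at this
  have hi : Integrable (fun ω => (psum X s ω - M) ^ 4) P :=
    integrable_of_abs_le (((h.measurable_psum s).sub_const M).pow_const 4)
      (C := (s.card + |M|) ^ 4) fun ω => by
        rw [abs_pow]
        exact pow_le_pow_left₀ (abs_nonneg _)
          ((abs_sub _ _).trans (by linarith [h.abs_psum_le s ω])) 4
  have h1 : ∫ ω, psum X s ω ^ 4 ∂P ≤ ∫ ω, (8 * (psum X s ω - M) ^ 4 + 8 * M ^ 4) ∂P := by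
    refine integral_mono (h.integrable_psum_pow s 4) ((hi.const_mul 8).add (integrable_const _))
      fun ω => ?_
    simp only
    set a := psum X s ω - M
    have : psum X s ω = a + M := by simp [a]
    rw [this]
    have e1 : (a + M) ^ 2 ≤ 2 * (a ^ 2 + M ^ 2) := by nlinarith [sq_nonneg (a - M)]
    have e2 : ((a + M) ^ 2) ^ 2 ≤ (2 * (a ^ 2 + M ^ 2)) ^ 2 :=
      pow_le_pow_left₀ (sq_nonneg _) e1 2
    nlinarith [sq_nonneg (a ^ 2 - M ^ 2)]
  rw [integral_add (hi.const_mul 8) (integrable_const _), integral_const_mul] at h1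
  have h2 := h.integral_centered_pow_four_le s
  rw [← hM] at h2
  have h3 := h.sum_second_le s
  have h4 : 0 ≤ ∑ i ∈ s, ∫ ω, X i ω ^ 2 ∂P :=
    Finset.sum_nonneg fun _ _ => integral_nonneg fun _ => sq_nonneg _
  have h5 := h.b₂_nonneg
  simp only [integral_const, probReal_univ, one_smul] at h1
  nlinarith

lemma exp_neg_sq_half_le {z : ℝ} (hz : 0 < z) : Real.exp (-z ^ 2 / 2) ≤ 8 / z ^ 4 := by
  have h1 := Real.sum_le_exp_of_nonneg (show 0 ≤ z ^ 2 / 2 by positivity) 3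
  simp only [Finset.sum_range_succ, Finset.sum_range_zero, Nat.factorial] at h1
  norm_num at h1
  have h2 := exp_mul_exp_neg_sq_half z
  have h3 : z ^ 4 / 8 ≤ Real.exp (z ^ 2 / 2) := by nlinarith [sq_nonneg z]
  rw [le_div_iff₀ (by positivity)]
  nlinarith [Real.exp_pos (-z ^ 2 / 2)]

/-- Factoring out `t - s` leaves at most `5 / 2` times the sum of two fourth powers, each at most `8
(w⁴ + 1)`. -/
lemma pow_five_sub_le {s t : ℝ} (w : ℝ) (hs : |s| ≤ 1) (ht : |t| ≤ 1) (hst : s ≤ t) :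
    (w + t) ^ 5 - (w + s) ^ 5 ≤ 40 * (t - s) * (w ^ 4 + 1) := by
  have key : ∀ r, |r| ≤ 1 → (w + r) ^ 4 ≤ 8 * (w ^ 4 + 1) := fun r hr => by
    have hr4 : r ^ 4 ≤ 1 := by
      have := pow_le_one₀ (n := 4) (abs_nonneg r) hr
      rwa [← abs_pow, abs_of_nonneg (by positivity)] at this
    have e1 : (w + r) ^ 2 ≤ 2 * (w ^ 2 + r ^ 2) := by nlinarith [sq_nonneg (w - r)]
    have e2 : ((w + r) ^ 2) ^ 2 ≤ (2 * (w ^ 2 + r ^ 2)) ^ 2 :=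
      pow_le_pow_left₀ (sq_nonneg _) e1 2
    nlinarith [sq_nonneg (w ^ 2 - r ^ 2)]
  set x := w + t
  set y := w + s
  have h1 : x ^ 4 + x ^ 3 * y + x ^ 2 * y ^ 2 + x * y ^ 3 + y ^ 4 ≤ 5 / 2 * (x ^ 4 + y ^ 4) := by
    have e1 : 2 * (x ^ 2 * y ^ 2) ≤ x ^ 4 + y ^ 4 := by nlinarith [sq_nonneg (x ^ 2 - y ^ 2)]
    have e2 : x ^ 3 * y + x * y ^ 3 ≤ x ^ 4 + y ^ 4 := by
      nlinarith [mul_nonneg (sq_nonneg (x - y)) (add_nonneg (sq_nonneg (x + y))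
        (add_nonneg (sq_nonneg x) (sq_nonneg y)))]
    linarith
  have h2 : x ^ 5 - y ^ 5
      = (t - s) * (x ^ 4 + x ^ 3 * y + x ^ 2 * y ^ 2 + x * y ^ 3 + y ^ 4) := by
    have : t - s = x - y := by simp only [x, y]; ring
    rw [this]; ring
  rw [h2, show 40 * (t - s) * (w ^ 4 + 1) = (t - s) * (40 * (w ^ 4 + 1)) by ring]
  refine mul_le_mul_of_nonneg_left ?_ (by linarith)
  linarith [key t ht, key s hs]

lemma integral_quarticEnvelope_le [DecidableEq ι] (h : TruncatedSummands P X b₂ b₃)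
    (s : Finset ι) {z : ℝ} (hz : 2 ≤ z) :
    ∫ ω, quarticEnvelope z (psum X s ω) ∂P ≤ 36 / z ^ 2 := by
  have hz0 : 0 < z := by linarith
  have hE := exp_neg_sq_half_le hz0
  have hi := h.integrable_psum_pow s 4
  have e : ∫ ω, quarticEnvelope z (psum X s ω) ∂P
      = 2 * Real.exp (-z ^ 2 / 2) + 2 / z ^ 4 * ∫ ω, psum X s ω ^ 4 ∂P := by
    simp only [quarticEnvelope, mul_div_right_comm]
    rw [integral_add (integrable_const _) (hi.const_mul _), integral_const_mul (2 / z ^ 4)]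
    simp
  have h1 : 2 / z ^ 4 * ∫ ω, psum X s ω ^ 4 ∂P ≤ 2 / z ^ 4 * 64 := by
    gcongr
    exact h.integral_psum_pow_four_le s
  rw [e]
  calc _ ≤ 2 * (8 / z ^ 4) + 2 / z ^ 4 * 64 := by linarith
    _ = 144 / z ^ 4 := by ring
    _ ≤ 36 / z ^ 2 := by
        rw [div_le_div_iff₀ (by positivity) (by positivity)]
        nlinarith [mul_nonneg (sq_nonneg z) (show (0 : ℝ) ≤ z ^ 2 - 4 by nlinarith)]

set_option maxHeartbeats 400000 in
/-- Concentration of the leave-one-out sums far from the origin. -/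
theorem concentration_large [DecidableEq ι] (h : TruncatedSummands P X b₂ b₃)
    (hb0 : 0 < b₂ + b₃) (hb : b₂ + b₃ ≤ 1 / 1000) (i : ι) {z a b : ℝ} (hz : 2 ≤ z)
    (hza : z / 2 ≤ a) (hab : a ≤ b) :
    P.real {ω | psum X (Finset.univ.erase i) ω ∈ Set.Icc a b}
      ≤ (500 * (b - a) + 1300 * (b₂ + b₃)) / z ^ 2 := by
  set s := Finset.univ.erase i with hs
  set β := b₂ + b₃ with hβ
  set d := 0.7 * β with hd
  have hd0 : 0 < d := by positivity
  have hz0 : 0 < z := by linarith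
  have hb2 := h.b₂_nonneg
  have hb3 := h.b₃_nonneg
  -- A growing `e` makes `d² / (4e)` of order `d / z²`. The term `e * p` is not absorbed into the
  -- coefficient but bounded by a fourth-moment Markov inequality. The centring `a - d` makes the
  -- test function nonnegative and zero to the left of `a - d`.
  have hc := h.concentration s (e := d * z ^ 2 / 2) hd0 (by positivity) hab (a - d)
  -- The test function lives on `w > a - d ≥ u`, since `a ≥ z / 2` and `d ≤ 0.0007`; there, powers
  -- of `w / u` may be inserted to reach the fourth moment.
  set u := 0.49 * z with hu
  have hu0 : 0 < u := by positivity
  have hud : u ≤ a - d := by rw [hu, hd]; linarith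
  set L := b - a + 2 * d with hL
  have hL0 : 0 ≤ L := by rw [hL]; linarith
  have hf0 : ∀ w, 0 ≤ clamp (a - d) (b + d) w - (a - d) := fun w => by
    linarith [(clamp_mem (show a - d ≤ b + d by linarith) w).1]
  have hfL : ∀ w, clamp (a - d) (b + d) w - (a - d) ≤ L := fun w => by
    linarith [(clamp_mem (show a - d ≤ b + d by linarith) w).2]
  have hfz : ∀ w, w ≤ a - d → clamp (a - d) (b + d) w - (a - d) = 0 := fun w hw => by
    rw [clamp, max_eq_left ((min_le_left _ _).trans hw), sub_self]
  have hf4 : ∀ w, clamp (a - d) (b + d) w - (a - d) ≤ L / u ^ 4 * w ^ 4 := fun w => by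
    rcases le_or_gt w (a - d) with hw | hw
    · rw [hfz w hw]; positivity
    · refine (hfL w).trans ?_
      rw [div_mul_eq_mul_div, le_div_iff₀ (by positivity)]
      have : u ≤ w := by linarith
      gcongr
  have hwf : ∀ w, w * (clamp (a - d) (b + d) w - (a - d)) ≤ L / u ^ 3 * w ^ 4 := fun w => by
    rcases le_or_gt w (a - d) with hw | hw
    · rw [hfz w hw, mul_zero]; positivity
    · have huw : u ≤ w := by linarith
      have hw0 : 0 < w := by linarith
      calc _ ≤ w * L := mul_le_mul_of_nonneg_left (hfL w) hw0.le
        _ = L * w := mul_comm _ _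
        _ ≤ L / u ^ 3 * w ^ 4 := by
          rw [div_mul_eq_mul_div, le_div_iff₀ (by positivity),
            show L * w ^ 4 = L * w * w ^ 3 by ring]
          gcongr
  have hfm : ∀ t, Measurable fun ω => clamp (a - d) (b + d) (psum X t ω) - (a - d) := fun t =>
    ((continuous_clamp _ _).measurable.comp (h.measurable_psum t)).sub_const _
  have hfb : ∀ w, |clamp (a - d) (b + d) w - (a - d)| ≤ L := fun w => by
    rw [abs_of_nonneg (hf0 w)]; exact hfL w
  have h1 : ∫ ω, psum X s ω * (clamp (a - d) (b + d) (psum X s ω) - (a - d)) ∂P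
      ≤ L / u ^ 3 * 64 := by
    calc _ ≤ ∫ ω, L / u ^ 3 * psum X s ω ^ 4 ∂P := by
          refine integral_mono ?_ ((h.integrable_psum_pow s 4).const_mul _) fun ω => hwf _
          refine integrable_of_abs_le ((h.measurable_psum s).mul (hfm s)) (C := s.card * L)
              fun ω => ?_
          rw [abs_mul]
          exact mul_le_mul (h.abs_psum_le s ω) (hfb _) (abs_nonneg _) (Nat.cast_nonneg _)
      _ = L / u ^ 3 * ∫ ω, psum X s ω ^ 4 ∂P := integral_const_mul _ _
      _ ≤ _ := by gcongr; exact h.integral_psum_pow_four_le s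
  have h2 : -(∑ j ∈ s, (∫ ω, X j ω ∂P)
      * ∫ ω, (clamp (a - d) (b + d) (psum X (s.erase j) ω) - (a - d)) ∂P)
      ≤ b₂ * (L / u ^ 4 * 64) := by
    refine (neg_le_abs _).trans ((Finset.abs_sum_le_sum_abs _ _).trans ?_)
    calc _ ≤ ∑ j ∈ s, |∫ ω, X j ω ∂P| * (L / u ^ 4 * 64) := by
          refine Finset.sum_le_sum fun j _ => ?_
          have hnn : 0 ≤ ∫ ω, (clamp (a - d) (b + d) (psum X (s.erase j) ω) - (a - d)) ∂P :=
            integral_nonneg fun ω => hf0 _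
          rw [abs_mul, abs_of_nonneg hnn]
          refine mul_le_mul_of_nonneg_left ?_ (abs_nonneg _)
          calc _ ≤ ∫ ω, L / u ^ 4 * psum X (s.erase j) ω ^ 4 ∂P :=
                integral_mono (integrable_of_abs_le (hfm _) fun ω => hfb _)
                  ((h.integrable_psum_pow _ 4).const_mul _) fun ω => hf4 _
            _ = L / u ^ 4 * ∫ ω, psum X (s.erase j) ω ^ 4 ∂P := integral_const_mul _ _
            _ ≤ _ := by gcongr; exact h.integral_psum_pow_four_le _
      _ = (∑ j ∈ s, |∫ ω, X j ω ∂P|) * (L / u ^ 4 * 64) := by rw [Finset.sum_mul]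
      _ ≤ _ := by gcongr; exact h.abs_sum_mean_le s
  set p := P.real {ω | psum X s ω ∈ Set.Icc a b} with hp
  have hp0 : 0 ≤ p := measureReal_nonneg
  have hmarkov : (z / 2) ^ 4 * p ≤ 64 := by
    refine le_trans ?_ (h.integral_psum_pow_four_le s)
    have hm : MeasurableSet {ω | psum X s ω ∈ Set.Icc a b} :=
      h.measurable_psum s measurableSet_Icc
    have : ∫ ω, {ω | psum X s ω ∈ Set.Icc a b}.indicator (fun _ => (z / 2) ^ 4) ω ∂P
        ≤ ∫ ω, psum X s ω ^ 4 ∂P := by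
      refine integral_mono ((integrable_const _).indicator hm) (h.integrable_psum_pow s 4)
        fun ω => ?_
      simp only
      by_cases hω : ω ∈ {ω | psum X s ω ∈ Set.Icc a b}
      · rw [Set.indicator_of_mem hω]
        have : z / 2 ≤ psum X s ω := hza.trans hω.1
        gcongr
      · rw [Set.indicator_of_notMem hω]; positivity
    rw [integral_indicator_const _ hm, smul_eq_mul, mul_comm] at this
    exact this
  have hκ := h.le_sum_mul_min hd0 i
  rw [← hs] at hκ
  set κ := ∑ j ∈ s, ∫ ω, |X j ω| * min |X j ω| d ∂P
  have hm1 : ∫ ω, |X i ω| ∂P ≤ 1 :=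
    (le_abs_self _).trans (abs_integral_le_const fun ω => by rw [abs_abs]; exact h.bdd i ω)
  have hm0 : 0 ≤ ∫ ω, |X i ω| ∂P := integral_nonneg fun _ => abs_nonneg _
  have hκ2 : 0.64 ≤ κ := by
    have e1 : b₃ / (4 * d) ≤ 1 / 2.8 := by
      rw [div_le_div_iff₀ (by positivity) (by norm_num), hd]
      linarith
    have e2 : d * ∫ ω, |X i ω| ∂P ≤ 0.7 * (1 / 1000) * 1 :=
      mul_le_mul (by rw [hd]; linarith) hm1 hm0 (by norm_num)
    norm_num at e1 e2 ⊢
    linarith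
  have hεp : d * z ^ 2 / 2 * p ≤ 512 * d / z ^ 2 := by
    rw [le_div_iff₀ (by positivity)]
    calc d * z ^ 2 / 2 * p * z ^ 2 = 8 * d * ((z / 2) ^ 4 * p) := by ring
      _ ≤ 8 * d * 64 := by gcongr
      _ = 512 * d := by ring
  have hε2 : d ^ 2 / (4 * (d * z ^ 2 / 2)) = d / 2 / z ^ 2 := by field_simp; norm_num
  have hu3 : L / u ^ 3 * 64 ≤ 273 * L / z ^ 2 := by
    rw [div_mul_eq_mul_div, div_le_div_iff₀ (by positivity) (by positivity), hu]
    have : 0 ≤ L * z ^ 2 * (z - 2) := mul_nonneg (by positivity) (by linarith)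
    have : 0 ≤ L * z ^ 2 := by positivity
    linarith
  have hu4 : b₂ * (L / u ^ 4 * 64) ≤ 1 * L / z ^ 2 := by
    have e1 : L / u ^ 4 * 64 ≤ 300 * L / z ^ 2 := by
      rw [div_mul_eq_mul_div, div_le_div_iff₀ (by positivity) (by positivity), hu]
      have : 0 ≤ L * z ^ 2 * (z ^ 2 - 4) := mul_nonneg (by positivity) (by nlinarith)
      have : 0 ≤ L * z ^ 2 := by positivity
      linarith
    calc b₂ * (L / u ^ 4 * 64) ≤ (1 / 1000) * (300 * L / z ^ 2) :=
          mul_le_mul (by linarith) e1 (by positivity) (by norm_num)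
      _ = 0.3 * L / z ^ 2 := by ring
      _ ≤ _ := by gcongr; norm_num
  have hmain : 0.64 * p ≤ (274 * L + 512.5 * d) / z ^ 2 := by
    have e1 : 0.64 * p ≤ κ * p := by gcongr
    have e2 : (κ - d * z ^ 2 / 2) * p = κ * p - d * z ^ 2 / 2 * p := by ring
    have e3 : (274 * L + 512.5 * d) / z ^ 2
        = 273 * L / z ^ 2 + 1 * L / z ^ 2 + 512 * d / z ^ 2 + d / 2 / z ^ 2 := by ring
    rw [hε2] at hc
    linarith
  rw [le_div_iff₀ (by positivity)] at hmain ⊢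
  rw [hL, hd] at hmain
  linarith

/-- The bound for large `z`. -/
theorem abs_sub_gaussLower_le_of_large [DecidableEq ι] (h : TruncatedSummands P X b₂ b₃)
    (hb0 : 0 < b₂ + b₃) (hb : b₂ + b₃ ≤ 1 / 1000) {S : Set ℝ} {z : ℝ} (hS : IsLeftRay S z)
    (hz : 2 ≤ z) :
    |P.real {ω | psum X Finset.univ ω ∈ S} - gaussLower z| ≤ 5000 * (b₂ + b₃) / z ^ 2 := by
  have hb2 := h.b₂_nonneg
  have hb3 := h.b₃_nonneg
  have hz0 : 0 < z := by linarith
  have henv : ∀ s, Integrable (fun ω => quarticEnvelope z (psum X s ω)) P := fun s => by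
    simp only [quarticEnvelope, mul_div_right_comm]
    exact (integrable_const _).add ((h.integrable_psum_pow s 4).const_mul _)
  -- `1900 = 1400 + 500` adds the increment of `w * f w` to the concentration slope; `36` and `72`
  -- come from the expected quartic envelope.
  have := h.abs_measureReal_sub_gaussLower_le hS hz0.le (A := 1900 / z ^ 2)
    (B := 36 / z ^ 2) (B' := 72 / z ^ 2) (C := 1300 * (b₂ + b₃) / z ^ 2) (by positivity)
    (by positivity) (by positivity) ?_ ?_ ?_
  · refine this.trans ?_
    rw [le_div_iff₀ (by positivity)]
    have e : (3 / 2 * (1900 / z ^ 2) * b₃ + 1300 * (b₂ + b₃) / z ^ 2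
        + (36 / z ^ 2 + 72 / z ^ 2) * b₂) * z ^ 2
        = 2850 * b₃ + 1300 * (b₂ + b₃) + 108 * b₂ := by
      field_simp
      ring
    rw [e]
    linarith
  · intro i s t hs ht
    refine h.abs_integral_steinDer_sub_le hS hz0.le _ ?_ hs ht
    intro s t hs ht hst
    set V := psum X (Finset.univ.erase i) with hV
    have hst' := sub_le_abs_add_abs s t
    have ht1 := abs_le.1 ht
    have hs1 := abs_le.1 hs
    -- `t ≤ 1 ≤ z / 2` keeps the interval to the right of `z / 2`.
    have h1 := h.concentration_large hb0 hb i hz (show z / 2 ≤ z - t by linarith)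
      (show z - t ≤ z - s by linarith)
    have h2 : |∫ ω, ((V ω + t) * steinSol z (V ω + t) - (V ω + s) * steinSol z (V ω + s)) ∂P|
        ≤ 1400 / z ^ 2 * (|s| + |t|) := by
      have hV4 := h.integrable_psum_pow (Finset.univ.erase i) 4
      have hV4' := h.integral_psum_pow_four_le (Finset.univ.erase i)
      rw [← hV] at hV4 hV4'
      set k := (1 + z ^ 2) / z
      have hk0 : 0 ≤ k := by positivity
      set E := Real.exp (-z ^ 2 / 2) with hE
      have hE1 : E ≤ 8 / z ^ 4 := exp_neg_sq_half_le hz0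
      -- A primitive of the envelope is quintic in `w`; its increments over a bounded shift again
      -- need only the fourth moment.
      have hQ : ∀ w, HasDerivAt (fun w => k * (2 * E * w + 2 / (5 * z ^ 4) * w ^ 5))
          (k * quarticEnvelope z w) w := fun w =>
        ((((hasDerivAt_id w).const_mul (2 * E)).add
          ((hasDerivAt_pow 5 w).const_mul (2 / (5 * z ^ 4)))).const_mul k).congr_deriv (by
            simp only [quarticEnvelope, ← hE]; field_simp; norm_num; ring)
      calc _ ≤ ∫ ω, k * (t - s) * (2 * E + 16 / z ^ 4 * (V ω ^ 4 + 1)) ∂P := by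
            refine abs_integral_le_of_abs_le (((integrable_const _).add
              ((hV4.add (integrable_const _)).const_mul _)).const_mul _) fun ω => ?_
            have hle : V ω + s ≤ V ω + t := by linarith
            have e1 := mul_steinSol_sub_le hQ (fun w => steinMulDer_le_quarticEnvelope hz0 w) hle
            have e2 := monotone_mul_steinSol z hle
            simp only at e2
            rw [abs_of_nonneg (by linarith)]
            refine e1.trans ?_
            have e3 := pow_five_sub_le (V ω) hs ht hst
            have e4 : k * (2 * E * (V ω + t) + 2 / (5 * z ^ 4) * (V ω + t) ^ 5)
                - k * (2 * E * (V ω + s) + 2 / (5 * z ^ 4) * (V ω + s) ^ 5)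
                = k * (2 * E * (t - s) + 2 / (5 * z ^ 4) * ((V ω + t) ^ 5 - (V ω + s) ^ 5)) := by
              ring
            rw [e4]
            calc _ ≤ k * (2 * E * (t - s) + 2 / (5 * z ^ 4) * (40 * (t - s) * (V ω ^ 4 + 1))) := by
                  gcongr
              _ = _ := by ring
        _ = k * (t - s) * (2 * E + 16 / z ^ 4 * ((∫ ω, V ω ^ 4 ∂P) + 1)) := by
            have i1 : Integrable (fun ω => V ω ^ 4 + 1) P := hV4.add (integrable_const _)
            rw [integral_const_mul, integral_add (integrable_const _) (i1.const_mul _),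
              integral_const_mul (16 / z ^ 4), integral_add hV4 (integrable_const _)]
            simp
        _ ≤ k * (|s| + |t|) * (2 * (8 / z ^ 4) + 16 / z ^ 4 * (64 + 1)) := by
            have : 0 ≤ ∫ ω, V ω ^ 4 ∂P := integral_nonneg fun _ => by positivity
            have : 0 ≤ E := (Real.exp_pos _).le
            gcongr
        _ = k * (1056 / z ^ 4) * (|s| + |t|) := by ring
        _ ≤ _ := by
            gcongr
            simp only [k]
            rw [div_mul_div_comm, div_le_div_iff₀ (by positivity) (by positivity)]
            have e1 : 0 ≤ z ^ 4 * (z - 2) := mul_nonneg (by positivity) (by linarith)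
            have e2 : 0 ≤ z ^ 2 * (z ^ 2 - 4) := mul_nonneg (by positivity) (by nlinarith)
            nlinarith
    have h3 : (500 * (z - s - (z - t)) + 1300 * (b₂ + b₃)) / z ^ 2
        ≤ 500 / z ^ 2 * (|s| + |t|) + 1300 * (b₂ + b₃) / z ^ 2 := by
      rw [add_div, mul_div_right_comm]
      gcongr
      linarith
    have h4 : 1900 / z ^ 2 * (|s| + |t|)
        = 1400 / z ^ 2 * (|s| + |t|) + 500 / z ^ 2 * (|s| + |t|) := by ring
    linarith
  · intro i
    refine le_trans ?_ (h.integral_quarticEnvelope_le (Finset.univ.erase i) hz)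
    refine integral_mono (integrable_of_abs_le
      ((continuous_steinSol z).measurable.comp (h.measurable_psum _)) (C := 1.26) fun ω => ?_)
      (henv _) fun ω => ?_
    · rw [abs_of_pos (steinSol_pos _ _)]; exact steinSol_le_of_nonneg hz0.le _
    · exact (steinSol_le_quarticEnvelope hz0 _).trans
        (div_le_self (quarticEnvelope_nonneg _ _) (by linarith))
  · refine (abs_integral_le_of_abs_le ((henv Finset.univ).const_mul 2) fun ω =>
      abs_steinDer_le_quarticEnvelope hS (by linarith) _).trans ?_
    rw [integral_const_mul]
    have := h.integral_quarticEnvelope_le Finset.univ hz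
    calc _ ≤ 2 * (36 / z ^ 2) := by gcongr
      _ = _ := by ring

end TruncatedSummands

end LargeValues

/-! ### Truncation of the original summands and assembly of the cases -/

section Truncation

/-- If both vanished, all summands would have zero second moment, against a total of `1 - b₂ = 1`.
Positivity allows clamping margins proportional to `b₂ + b₃`. -/
lemma TruncatedSummands.b₂_add_b₃_pos {Ω ι : Type*} [MeasurableSpace Ω] [Fintype ι]
    {P : Measure Ω} [IsProbabilityMeasure P] {X : ι → Ω → ℝ} {b₂ b₃ : ℝ}
    (h : TruncatedSummands P X b₂ b₃) : 0 < b₂ + b₃ := by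
  by_contra! hle
  have hb2 := h.b₂_nonneg
  have hb3 := h.b₃_nonneg
  have hz : ∀ i, ∫ ω, X i ω ^ 2 ∂P ≤ 0 := fun i => by
    have h1 := h.integral_abs_cube_le i
    have h2 : ∫ ω, |X i ω| ∂P ≤ 0 := by
      by_contra! hpos
      have := pow_pos hpos 3
      linarith
    refine le_trans (integral_mono (h.integrable_pow i 2) (h.integrable i).abs fun ω => ?_) h2
    simp only
    rw [← sq_abs]
    nlinarith [abs_nonneg (X i ω), h.bdd i ω]
  have := Finset.sum_nonpos fun i (_ : i ∈ Finset.univ) => hz i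
  linarith [h.second]

/-- One-sided Chebyshev inequality for a centred variable of unit variance. -/
lemma measureReal_ge_le_of_centered {Ω : Type*} [MeasurableSpace Ω] {P : Measure Ω}
    [IsProbabilityMeasure P] {W : Ω → ℝ} (hW : Measurable W) (hL : MemLp W 2 P)
    (hmean : ∫ ω, W ω ∂P = 0) (hvar : ∫ ω, W ω ^ 2 ∂P = 1) {z : ℝ} (hz : 0 ≤ z) :
    P.real {ω | z ≤ W ω} ≤ 1 / (1 + z ^ 2) := by
  have hm : MeasurableSet {ω | z ≤ W ω} := measurableSet_le measurable_const hW
  have hi1 : Integrable W P := hL.integrable (by norm_num)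
  have hi2 : Integrable (fun ω => W ω ^ 2) P := hL.integrable_sq
  have hi12 : Integrable (fun ω => z ^ 2 * W ω ^ 2 + 2 * z * W ω) P :=
    (hi2.const_mul _).add (hi1.const_mul _)
  have h1 : ∫ ω, {ω | z ≤ W ω}.indicator (fun _ => (1 + z ^ 2) ^ 2) ω ∂P
      ≤ ∫ ω, (z ^ 2 * W ω ^ 2 + 2 * z * W ω + 1) ∂P := by
    refine integral_mono ((integrable_const _).indicator hm) (hi12.add (integrable_const _))
      fun ω => ?_
    -- Markov's inequality for `(1 + zW)²`, whose mean is `1 + z²` and which is at least `(1 + z²)²`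
    -- on `W ≥ z`.
    have e : z ^ 2 * W ω ^ 2 + 2 * z * W ω + 1 = (1 + z * W ω) ^ 2 := by ring
    simp only
    rw [e]
    by_cases hω : ω ∈ {ω | z ≤ W ω}
    · rw [Set.indicator_of_mem hω]
      have : z ≤ W ω := hω
      gcongr
      nlinarith
    · rw [Set.indicator_of_notMem hω]; positivity
  rw [integral_indicator_const _ hm, integral_add hi12 (integrable_const _),
    integral_add (hi2.const_mul _) (hi1.const_mul _), integral_const_mul, integral_const_mul,
    hmean, hvar] at h1
  simp only [smul_eq_mul, mul_one, mul_zero, add_zero, integral_const, probReal_univ] at h1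
  have hz2 : 0 < 1 + z ^ 2 := by positivity
  rw [le_div_iff₀ hz2]
  refine le_of_mul_le_mul_right ?_ hz2
  linarith

lemma gaussLower_eq_cdf (z : ℝ) : gaussLower z = cdf (gaussianReal 0 1) z := by
  rw [cdf_eq_real, gaussianReal_real_Iic, gaussLower]

/-- The one-sided Chebyshev inequality applied to the standard normal law itself. -/
lemma gaussUpper_le_inv {z : ℝ} (hz : 0 ≤ z) : gaussUpper z ≤ 1 / (1 + z ^ 2) := by
  have hL : MemLp (fun x : ℝ => x) 2 (gaussianReal 0 1) := memLp_id_gaussianReal 2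
  have hmean : ∫ x, x ∂(gaussianReal 0 1) = 0 := integral_id_gaussianReal
  have hvar : ∫ x, x ^ 2 ∂(gaussianReal 0 1) = 1 := by
    have h1 := variance_of_integral_eq_zero (μ := gaussianReal 0 1) (X := fun x : ℝ => x)
      measurable_id.aemeasurable hmean
    rw [← h1, variance_fun_id_gaussianReal]
    rfl
  refine le_trans ?_ (measureReal_ge_le_of_centered measurable_id hL hmean hvar hz)
  have h1 : gaussUpper z = (gaussianReal 0 1).real (Set.Iic z)ᶜ := by
    rw [probReal_compl_eq_one_sub measurableSet_Iic, gaussianReal_real_Iic]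
    have := gaussLower_add_gaussUpper z
    rw [gaussLower] at this
    linarith
  rw [h1]
  exact measureReal_mono fun x hx => le_of_lt (not_le.1 (show ¬ x ≤ z from hx))

variable {Ω ι : Type*} [MeasurableSpace Ω] [Fintype ι] {P : Measure Ω} [IsProbabilityMeasure P]
  {ξ : ι → Ω → ℝ}

/-- Independent centred summands of total variance one. -/
structure NormalizedSummands (P : Measure Ω) (ξ : ι → Ω → ℝ) : Prop where
  meas : ∀ i, Measurable (ξ i)
  indep : iIndepFun ξ P
  memLp : ∀ i, MemLp (ξ i) 2 P
  mean : ∀ i, ∫ ω, ξ i ω ∂P = 0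
  var : ∑ i, variance (ξ i) P = 1

/-- The large-value part of the second moments. -/
noncomputable def largeSecond (P : Measure Ω) (ξ : ι → Ω → ℝ) : ℝ :=
  ∑ i, ∫ ω, Set.indicator {ω | 1 < |ξ i ω|} (fun ω => ξ i ω ^ 2) ω ∂P

/-- The small-value part of the third moments. -/
noncomputable def smallThird (P : Measure Ω) (ξ : ι → Ω → ℝ) : ℝ :=
  ∑ i, ∫ ω, Set.indicator {ω | |ξ i ω| ≤ 1} (fun ω => |ξ i ω| ^ 3) ω ∂P

/-- Replace values larger than one in absolute value by zero. -/
noncomputable def unitTrunc (x : ℝ) : ℝ := if |x| ≤ 1 then x else 0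

lemma measurable_unitTrunc : Measurable unitTrunc :=
  Measurable.ite (measurableSet_le measurable_id.abs measurable_const) measurable_id
    measurable_const

lemma unitTrunc_of_le {x : ℝ} (h : |x| ≤ 1) : unitTrunc x = x := if_pos h

lemma unitTrunc_of_lt {x : ℝ} (h : 1 < |x|) : unitTrunc x = 0 := if_neg (not_le.2 h)

lemma abs_unitTrunc_le (x : ℝ) : |unitTrunc x| ≤ 1 := by
  unfold unitTrunc; split_ifs with h <;> simp [*]

namespace NormalizedSummands

lemma measurableSet_large (h : NormalizedSummands P ξ) (i : ι) (r : ℝ) :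
    MeasurableSet {ω | r < |ξ i ω|} := measurableSet_lt measurable_const (h.meas i).abs

lemma integral_sq (h : NormalizedSummands P ξ) (i : ι) :
    ∫ ω, ξ i ω ^ 2 ∂P = variance (ξ i) P :=
  (variance_of_integral_eq_zero (h.meas i).aemeasurable (h.mean i)).symm

lemma integrable_large (h : NormalizedSummands P ξ) (i : ι) :
    Integrable (Set.indicator {ω | 1 < |ξ i ω|} fun ω => ξ i ω ^ 2) P :=
  (h.memLp i).integrable_sq.indicator (h.measurableSet_large i 1)

/-- Since `ξ i` is centred, the mean of its truncation is minus that of the part above one, at most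
`E[ξ i² ; |ξ i| > 1]` in absolute value. The same quantity is the second moment lost, so `β₂` plays
both roles. -/
theorem truncatedSummands (h : NormalizedSummands P ξ) :
    TruncatedSummands P (fun i ω => unitTrunc (ξ i ω)) (largeSecond P ξ) (smallThird P ξ) where
  meas i := measurable_unitTrunc.comp (h.meas i)
  indep := h.indep.comp (fun _ => unitTrunc) fun _ => measurable_unitTrunc
  bdd i ω := abs_unitTrunc_le _
  mean := by
    refine Finset.sum_le_sum fun i _ => ?_
    have hX : Integrable (fun ω => unitTrunc (ξ i ω)) P :=
      integrable_of_abs_le (measurable_unitTrunc.comp (h.meas i)) fun ω => abs_unitTrunc_le _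
    have e : ∫ ω, unitTrunc (ξ i ω) ∂P = ∫ ω, (unitTrunc (ξ i ω) - ξ i ω) ∂P := by
      rw [integral_sub hX ((h.memLp i).integrable (by norm_num)), h.mean i, sub_zero]
    rw [e]
    refine abs_integral_le_of_abs_le (h.integrable_large i) fun ω => ?_
    by_cases hω : 1 < |ξ i ω|
    · rw [Set.indicator_of_mem (by exact hω), unitTrunc_of_lt hω, zero_sub, abs_neg, ← sq_abs]
      nlinarith
    · rw [Set.indicator_of_notMem (by exact hω), unitTrunc_of_le (not_lt.1 hω)]
      simp
  second := by
    rw [← h.var, largeSecond, ← Finset.sum_sub_distrib]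
    refine Finset.sum_congr rfl fun i _ => ?_
    rw [← h.integral_sq, ← integral_sub (h.memLp i).integrable_sq (h.integrable_large i)]
    congr 1 with ω
    by_cases hω : 1 < |ξ i ω|
    · rw [Set.indicator_of_mem (by exact hω), unitTrunc_of_lt hω]; ring
    · rw [Set.indicator_of_notMem (by exact hω), unitTrunc_of_le (not_lt.1 hω), sub_zero]
  third := by
    refine Finset.sum_congr rfl fun i _ => ?_
    congr 1 with ω
    by_cases hω : |ξ i ω| ≤ 1
    · rw [Set.indicator_of_mem (by exact hω), unitTrunc_of_le hω]
    · rw [Set.indicator_of_notMem (by exact hω), unitTrunc_of_lt (not_le.1 hω)]; simp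

lemma measurable_psum (h : NormalizedSummands P ξ) (s : Finset ι) : Measurable (psum ξ s) :=
  Finset.measurable_fun_sum s fun i _ => h.meas i

lemma memLp_psum (h : NormalizedSummands P ξ) (s : Finset ι) : MemLp (psum ξ s) 2 P :=
  memLp_finsetSum s fun i _ => h.memLp i

lemma integral_psum (h : NormalizedSummands P ξ) (s : Finset ι) :
    ∫ ω, psum ξ s ω ∂P = 0 := by
  have : ∫ ω, psum ξ s ω ∂P = ∑ i ∈ s, ∫ ω, ξ i ω ∂P :=
    integral_finsetSum s fun i _ => (h.memLp i).integrable (by norm_num)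
  rw [this]
  exact Finset.sum_eq_zero fun i _ => h.mean i

lemma integral_psum_sq (h : NormalizedSummands P ξ) (s : Finset ι) :
    ∫ ω, psum ξ s ω ^ 2 ∂P = ∑ i ∈ s, variance (ξ i) P := by
  have e : psum ξ s = ∑ i ∈ s, ξ i := by ext ω; simp [psum]
  rw [← IndepFun.variance_sum (fun i _ => h.memLp i) fun i _ j _ hij => h.indep.indepFun hij, ← e]
  exact (variance_of_integral_eq_zero (h.measurable_psum s).aemeasurable (h.integral_psum s)).symm

lemma integral_psum_sq_le (h : NormalizedSummands P ξ) (s : Finset ι) :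
    ∫ ω, psum ξ s ω ^ 2 ∂P ≤ 1 := by
  rw [h.integral_psum_sq, ← h.var]
  exact Finset.sum_le_univ_sum_of_nonneg fun i => variance_nonneg _ _

lemma sum_measureReal_large_le (h : NormalizedSummands P ξ) :
    ∑ i, P.real {ω | 1 < |ξ i ω|} ≤ largeSecond P ξ := by
  refine Finset.sum_le_sum fun i _ => ?_
  rw [← integral_indicator_one (h.measurableSet_large i 1)]
  refine integral_mono ((integrable_const (1 : ℝ)).indicator (h.measurableSet_large i 1))
    (h.integrable_large i) fun ω => ?_
  refine Set.indicator_le_indicator' fun hω => ?_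
  have hω' : 1 < |ξ i ω| := hω
  rw [← sq_abs]
  simp only [Pi.one_apply]
  nlinarith

/-- Without assumptions on the summands beyond normalization. -/
lemma abs_sub_gaussLower_le_trivial (h : NormalizedSummands P ξ) {S : Set ℝ} {z : ℝ}
    (hS : IsLeftRay S z) (hz : 0 ≤ z) :
    |P.real {ω | psum ξ Finset.univ ω ∈ S} - gaussLower z| ≤ 1 / (1 + z ^ 2) := by
  have hvar : ∫ ω, psum ξ Finset.univ ω ^ 2 ∂P = 1 := by rw [h.integral_psum_sq, h.var]
  have h1 := measureReal_ge_le_of_centered (h.measurable_psum _) (h.memLp_psum Finset.univ)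
    (h.integral_psum _) hvar hz
  have h2 := gaussUpper_le_inv hz
  have h3 := gaussUpper_pos z
  have h4 := gaussLower_add_gaussUpper z
  have hm : MeasurableSet {ω | psum ξ Finset.univ ω ∈ S} :=
    h.measurable_psum _ hS.measurableSet
  have h5 := probReal_compl_eq_one_sub (μ := P) hm
  have h6 : P.real {ω | psum ξ Finset.univ ω ∈ S}ᶜ ≤ P.real {ω | z ≤ psum ξ Finset.univ ω} :=
    measureReal_mono fun ω hω => hS.le_of_notMem hω
  have h7 : 0 ≤ P.real {ω | psum ξ Finset.univ ω ∈ S}ᶜ := measureReal_nonneg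
  rw [abs_le]
  constructor <;> linarith

/-- Two events that agree off `E`. -/
lemma abs_measureReal_sub_le {A B E : Set Ω} (hA : MeasurableSet A) (hB : MeasurableSet B)
    (hAB : ∀ ω, ω ∉ E → (ω ∈ A ↔ ω ∈ B)) {r : ℝ} (h1 : P.real (Aᶜ ∩ E) ≤ r)
    (h2 : P.real (Bᶜ ∩ E) ≤ r) : |P.real A - P.real B| ≤ r := by
  have key : ∀ {C D : Set Ω}, (∀ ω, ω ∉ E → (ω ∈ C ↔ ω ∈ D)) →
      P.real Dᶜ ≤ P.real Cᶜ + P.real (Dᶜ ∩ E) := fun {C D} hCD => by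
    refine le_trans (measureReal_mono ?_) (measureReal_union_le _ _)
    intro ω hω
    by_cases hE : ω ∈ E
    · exact Or.inr ⟨hω, hE⟩
    · exact Or.inl fun hC => hω ((hCD ω hE).1 hC)
  have k1 := key hAB
  have k2 := key fun ω hω => (hAB ω hω).symm
  rw [probReal_compl_eq_one_sub hA, probReal_compl_eq_one_sub hB] at k1 k2
  rw [abs_le]
  constructor <;> linarith

lemma psum_unitTrunc_eq {ω : Ω} (hω : ω ∉ ⋃ i, {ω | 1 < |ξ i ω|}) (s : Finset ι) :
    psum (fun i ω => unitTrunc (ξ i ω)) s ω = psum ξ s ω := by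
  refine Finset.sum_congr rfl fun i _ => ?_
  simp only [Set.mem_iUnion, Set.mem_ofPred_eq, not_exists, not_lt] at hω
  exact unitTrunc_of_le (hω i)

lemma measureReal_inter_iUnion_le (A : Set Ω) (E : ι → Set Ω) :
    P.real (A ∩ ⋃ i, E i) ≤ ∑ i, P.real (A ∩ E i) := by
  rw [Set.inter_iUnion]
  exact measureReal_iUnion_fintype_le _

/-- Cost of truncation for small thresholds. -/
lemma abs_truncation_le (h : NormalizedSummands P ξ) {S : Set ℝ} (hS : MeasurableSet S) :
    |P.real {ω | psum ξ Finset.univ ω ∈ S}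
      - P.real {ω | psum (fun i ω => unitTrunc (ξ i ω)) Finset.univ ω ∈ S}|
      ≤ largeSecond P ξ := by
  have key : ∀ A : Set Ω, P.real (A ∩ ⋃ i, {ω | 1 < |ξ i ω|}) ≤ largeSecond P ξ := fun A =>
    (measureReal_inter_iUnion_le A _).trans ((Finset.sum_le_sum fun i _ =>
      measureReal_mono Set.inter_subset_right).trans h.sum_measureReal_large_le)
  refine abs_measureReal_sub_le (E := ⋃ i, {ω | 1 < |ξ i ω|}) (h.measurable_psum _ hS)
    (h.truncatedSummands.measurable_psum _ hS) (fun ω hω => ?_) (key _) (key _)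
  show psum ξ Finset.univ ω ∈ S ↔ psum (fun i ω => unitTrunc (ξ i ω)) Finset.univ ω ∈ S
  rw [psum_unitTrunc_eq hω]

/-- Composing coordinate `i` with the identity and all others with `g` keeps the family independent.
Both the original sums (`g` the identity) and the truncated ones are covered. -/
lemma indepFun_psum_comp [DecidableEq ι] (h : NormalizedSummands P ξ) (i : ι) {g : ℝ → ℝ}
    (hg : Measurable g) :
    IndepFun (ξ i) (psum (fun j ω => g (ξ j ω)) (Finset.univ.erase i)) P := by
  have hG : ∀ j, Measurable (if j = i then id else g) := fun j => by
    split_ifs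
    · exact measurable_id
    · exact hg
  have hind := h.indep.comp (fun j => if j = i then id else g) hG
  have h1 := (hind.indepFun_finsetSum_of_notMem (fun j => (hG j).comp (h.meas j))
    (Finset.notMem_erase i Finset.univ)).symm
  simp only [if_true, Function.id_comp] at h1
  convert h1 using 1
  ext ω
  rw [psum, Finset.sum_apply]
  refine Finset.sum_congr rfl fun j hj => ?_
  simp [Finset.ne_of_mem_erase hj]

lemma measureReal_large_inter_le [DecidableEq ι] (h : NormalizedSummands P ξ) (i : ι)
    {g : ℝ → ℝ} (hg : Measurable g) {r : ℝ} (hr : 0 < r)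
    (hi : Integrable (fun ω => psum (fun j ω => g (ξ j ω)) (Finset.univ.erase i) ω ^ 2) P)
    (hle : ∫ ω, psum (fun j ω => g (ξ j ω)) (Finset.univ.erase i) ω ^ 2 ∂P ≤ 1) :
    P.real ({ω | 1 < |ξ i ω|} ∩ {ω | r ≤ psum (fun j ω => g (ξ j ω)) (Finset.univ.erase i) ω})
      ≤ P.real {ω | 1 < |ξ i ω|} / r ^ 2 := by
  set V := psum (fun j ω => g (ξ j ω)) (Finset.univ.erase i)
  have hVm : Measurable V := Finset.measurable_fun_sum _ fun j _ => hg.comp (h.meas j)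
  have hm : MeasurableSet {ω | r ≤ V ω} := measurableSet_le measurable_const hVm
  have hmarkov : r ^ 2 * P.real {ω | r ≤ V ω} ≤ 1 := by
    refine le_trans ?_ hle
    have : ∫ ω, {ω | r ≤ V ω}.indicator (fun _ => r ^ 2) ω ∂P ≤ ∫ ω, V ω ^ 2 ∂P := by
      refine integral_mono ((integrable_const _).indicator hm) hi fun ω => ?_
      simp only
      by_cases hω : ω ∈ {ω | r ≤ V ω}
      · rw [Set.indicator_of_mem hω]
        have : r ≤ V ω := hω
        gcongr
      · rw [Set.indicator_of_notMem hω]; positivity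
    rwa [integral_indicator_const _ hm, smul_eq_mul, mul_comm] at this
  have hprod : P.real ({ω | 1 < |ξ i ω|} ∩ {ω | r ≤ V ω})
      = P.real {ω | 1 < |ξ i ω|} * P.real {ω | r ≤ V ω} := by
    have := (h.indepFun_psum_comp i hg).measure_inter_preimage_eq_mul {x : ℝ | 1 < |x|} (Set.Ici r)
      (measurableSet_lt measurable_const measurable_id.abs) measurableSet_Ici
    rw [measureReal_def, measureReal_def, measureReal_def, ← ENNReal.toReal_mul]
    exact congrArg ENNReal.toReal this
  rw [hprod, le_div_iff₀ (by positivity)]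
  have := mul_le_mul_of_nonneg_left hmarkov (measureReal_nonneg (μ := P) (s := {ω | 1 < |ξ i ω|}))
  linarith

/-- Cost of truncation for large thresholds. -/
lemma abs_truncation_le_of_large [DecidableEq ι] (h : NormalizedSummands P ξ) {S : Set ℝ} {z : ℝ}
    (hS : IsLeftRay S z) (hz : 0 < z) :
    |P.real {ω | psum ξ Finset.univ ω ∈ S}
      - P.real {ω | psum (fun i ω => unitTrunc (ξ i ω)) Finset.univ ω ∈ S}|
      ≤ (∑ i, P.real {ω | z / 4 < |ξ i ω|}) + 4 / z ^ 2 * largeSecond P ξ := by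
  have hT := h.truncatedSummands
  have hsum : ∑ i, 4 / z ^ 2 * P.real {ω | 1 < |ξ i ω|} ≤ 4 / z ^ 2 * largeSecond P ξ := by
    rw [← Finset.mul_sum]
    have := h.sum_measureReal_large_le
    gcongr
  refine abs_measureReal_sub_le (E := ⋃ i, {ω | 1 < |ξ i ω|})
    (h.measurable_psum _ hS.measurableSet) (hT.measurable_psum _ hS.measurableSet)
    (fun ω hω => ?_) ?_ ?_
  · show psum ξ Finset.univ ω ∈ S ↔ psum (fun i ω => unitTrunc (ξ i ω)) Finset.univ ω ∈ S
    rw [psum_unitTrunc_eq hω]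
  · refine (measureReal_inter_iUnion_le _ _).trans (le_trans ?_ (add_le_add_right hsum _))
    rw [← Finset.sum_add_distrib]
    refine Finset.sum_le_sum fun i _ => ?_
    -- If `W ≥ z` and `|ξ i| ≤ z / 4`, the remaining sum is at least `3z / 4`; Chebyshev gives `16 /
    -- 9 ≤ 4` over `z²`.
    have hb := h.measureReal_large_inter_le i (g := fun x => x) measurable_id
      (r := 3 * z / 4) (by positivity) (h.memLp_psum _).integrable_sq (h.integral_psum_sq_le _)
    have hb' : P.real {ω | 1 < |ξ i ω|} / (3 * z / 4) ^ 2
        ≤ 4 / z ^ 2 * P.real {ω | 1 < |ξ i ω|} := by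
      rw [div_mul_eq_mul_div, div_le_div_iff₀ (by positivity) (by positivity)]
      have : 0 ≤ P.real {ω | 1 < |ξ i ω|} * z ^ 2 := by positivity
      linarith
    refine le_trans ((measureReal_mono ?_).trans (measureReal_union_le _ _))
      (add_le_add_right (hb.trans hb') _)
    rintro ω ⟨hω, hωi⟩
    by_cases hlt : z / 4 < |ξ i ω|
    · exact Or.inl hlt
    · refine Or.inr ⟨hωi, ?_⟩
      have e1 : z ≤ psum ξ Finset.univ ω := hS.le_of_notMem hω
      have e2 := TruncatedSummands.psum_erase (X := ξ) (Finset.mem_univ i) ω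
      have e3 := le_abs_self (ξ i ω)
      show 3 * z / 4 ≤ psum ξ (Finset.univ.erase i) ω
      rw [e2]
      linarith
  · refine (measureReal_inter_iUnion_le _ _).trans ?_
    refine le_trans ?_ (hsum.trans (le_add_of_nonneg_left
      (Finset.sum_nonneg fun _ _ => measureReal_nonneg)))
    refine Finset.sum_le_sum fun i _ => ?_
    -- When `|ξ i| > 1` the truncated summand is zero, so the remaining truncated sum alone reaches
    -- `z` and no term `P(|ξ i| > z / 4)` arises.
    have hb := h.measureReal_large_inter_le i measurable_unitTrunc hz
      (hT.integrable_psum_pow _ 2) (hT.integral_psum_sq_le_one _)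
    have hb' : P.real {ω | 1 < |ξ i ω|} / z ^ 2 ≤ 4 / z ^ 2 * P.real {ω | 1 < |ξ i ω|} := by
      rw [div_mul_eq_mul_div]
      have : 0 ≤ P.real {ω | 1 < |ξ i ω|} := measureReal_nonneg
      gcongr
      linarith
    refine le_trans (measureReal_mono ?_) (hb.trans hb')
    rintro ω ⟨hω, hωi⟩
    refine ⟨hωi, ?_⟩
    have e1 : z ≤ psum (fun i ω => unitTrunc (ξ i ω)) Finset.univ ω := hS.le_of_notMem hω
    have e2 := TruncatedSummands.psum_erase (X := fun i ω => unitTrunc (ξ i ω)) (Finset.mem_univ i) ω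
    have e3 : unitTrunc (ξ i ω) = 0 := unitTrunc_of_lt hωi
    show z ≤ psum (fun i ω => unitTrunc (ξ i ω)) (Finset.univ.erase i) ω
    rw [e2]
    simp only [e3]
    linarith

lemma neg (h : NormalizedSummands P ξ) : NormalizedSummands P (fun i ω => -ξ i ω) where
  meas i := (h.meas i).neg
  indep := h.indep.comp (fun _ x => -x) fun _ => measurable_neg
  memLp i := (h.memLp i).neg
  mean i := by rw [integral_neg, h.mean i, neg_zero]
  var := by
    rw [← h.var]
    refine Finset.sum_congr rfl fun i _ => ?_
    exact variance_neg

/-- The non-uniform bound at a non-negative point, for open and closed left half-lines. -/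
theorem abs_sub_gaussLower_le [DecidableEq ι] (h : NormalizedSummands P ξ) {S : Set ℝ} {z : ℝ}
    (hS : IsLeftRay S z) (hz : 0 ≤ z) :
    |P.real {ω | psum ξ Finset.univ ω ∈ S} - gaussLower z|
      ≤ 2 * ∑ i, P.real {ω | max 1 |z| / 4 < |ξ i ω|}
        + constTwo (largeSecond P ξ + smallThird P ξ) z * ((1 + |z|) ^ 2)⁻¹
          * (largeSecond P ξ + smallThird P ξ) := by
  have hT := h.truncatedSummands
  have hb0 := hT.b₂_add_b₃_pos
  have hb2 := hT.b₂_nonneg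
  have hb3 := hT.b₃_nonneg
  have htriv := h.abs_sub_gaussLower_le_trivial hS hz
  have htr := h.abs_truncation_le hS.measurableSet
  have htrl := fun hz0 : 0 < z => h.abs_truncation_le_of_large hS hz0
  have habs := abs_sub_le (P.real {ω | psum ξ Finset.univ ω ∈ S})
    (P.real {ω | psum (fun i ω => unitTrunc (ξ i ω)) Finset.univ ω ∈ S}) (gaussLower z)
  have hsmall := fun hb => hT.abs_sub_gaussLower_le_of_small hb0 hb hS hz
  have hmod := fun hb hz0 => hT.abs_sub_gaussLower_le_of_moderate hb0 hb hS (z := z) hz0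
  have hlarge := fun hb hz2 => hT.abs_sub_gaussLower_le_of_large hb0 hb hS (z := z) hz2
  rw [abs_of_nonneg hz]
  have hsum0 : 0 ≤ ∑ i, P.real {ω | max 1 z / 4 < |ξ i ω|} :=
    Finset.sum_nonneg fun _ _ => measureReal_nonneg
  set D := |P.real {ω | psum ξ Finset.univ ω ∈ S} - gaussLower z|
  set b₂ := largeSecond P ξ
  set b₃ := smallThird P ξ
  set y := ((1 + z) ^ 2)⁻¹ with hy
  have hy0 : 0 < y := by positivity
  have hyz : y * (1 + z) ^ 2 = 1 := inv_mul_cancel₀ (by positivity)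
  have htriv' : D ≤ 2 * y := by
    refine htriv.trans ?_
    rw [div_le_iff₀ (by positivity)]
    have : (1 + z) ^ 2 ≤ 2 * (1 + z ^ 2) := by nlinarith [sq_nonneg (1 - z)]
    nlinarith [mul_le_mul_of_nonneg_left this hy0.le]
  -- The Chebyshev bound is at most `2 / (1 + z)²`, so any constant `c` with `c β ≥ 2` is immediate.
  -- This settles `β ≥ 1`, and below leaves only `β < 2 / 37` or `β < 1 / 1000`.
  have hfromtriv : ∀ c, 2 ≤ c * (b₂ + b₃) → D ≤ c * y * (b₂ + b₃) := fun c hc => by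
    refine htriv'.trans ?_
    nlinarith [mul_le_mul_of_nonneg_right hc hy0.le]
  suffices hmain : D ≤ 2 * ∑ i, P.real {ω | max 1 z / 4 < |ξ i ω|}
      + constTwo (b₂ + b₃) z * y * (b₂ + b₃) from hmain
  rw [constTwo, abs_of_nonneg hz]
  split_ifs with h1 h2
  · linarith [hfromtriv 15 (by linarith)]
  · rcases le_or_gt (2 / 37) (b₂ + b₃) with hb | hb
    · linarith [hfromtriv 37 (by linarith)]
    suffices D ≤ 37 * y * (b₂ + b₃) by linarith
    -- `37 / 2.45²` is about `6.16`, just above the uniform constant `6.13`; beyond `1.45` the bound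
    -- must use decay in `z`.
    rcases le_or_gt z 1.45 with hz1 | hz1
    · have hs := hsmall hb.le
      have : 6.13 ≤ 37 * y := by
        have hsq : (1 + z) ^ 2 ≤ 2.45 ^ 2 := by gcongr; linarith
        nlinarith
      nlinarith
    · have hz0 : 0 < z := by linarith
      have hs := hmod hb.le hz0
      have hk := TruncatedSummands.moderate_constant_le hz1.le h2
      -- `3.44 = 2.44 + 1`, the last unit being the cost of truncation.
      have hk2 : 1 / z + 3.44 ≤ 37 * y := by
        rw [hy, ← div_eq_mul_inv, div_add' _ _ _ hz0.ne',
          div_le_div_iff₀ hz0 (by positivity)]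
        nlinarith [mul_nonneg (show (0 : ℝ) ≤ z - 1.45 by linarith)
          (show (0 : ℝ) ≤ 2 - z by linarith), mul_nonneg hz0.le (mul_nonneg
          (show (0 : ℝ) ≤ z - 1.45 by linarith) (show (0 : ℝ) ≤ 2 - z by linarith))]
      have e1 := mul_le_mul_of_nonneg_right hk hb3
      have e2 := mul_le_mul_of_nonneg_right hk2 hb2
      rw [← hy] at e1
      linarith
  · have hz2 : 2 < z := not_le.1 h2
    have hz0 : 0 < z := by linarith
    rcases le_or_gt (1 / 1000) (b₂ + b₃) with hb | hb
    · linarith [hfromtriv 25431 (by linarith)]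
    have hs := hlarge hb.le hz2.le
    have ht := htrl hz0
    rw [max_eq_right (by linarith : 1 ≤ z)] at hsum0 ⊢
    -- For `z ≥ 2`, `(1 + z) / z ≤ 3 / 2`. The final constant needed is `2.25 * 5004 = 11259`,
    -- within `25431`.
    have hyz2 : 1 / z ^ 2 ≤ 2.25 * y := by
      rw [hy, ← div_eq_mul_inv, div_le_div_iff₀ (by positivity) (by positivity)]
      nlinarith
    have e1 : 4 / z ^ 2 * b₂ + 5000 * (b₂ + b₃) / z ^ 2 ≤ 1 / z ^ 2 * (5004 * (b₂ + b₃)) := by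
      have : 1 / z ^ 2 * (5004 * (b₂ + b₃)) = 4 / z ^ 2 * b₂ + 5000 * (b₂ + b₃) / z ^ 2
          + 4 / z ^ 2 * b₃ := by ring
      rw [this]
      exact le_add_of_nonneg_right (by positivity)
    have e2 : 1 / z ^ 2 * (5004 * (b₂ + b₃)) ≤ 2.25 * y * (5004 * (b₂ + b₃)) := by gcongr
    have e3 : 0 ≤ y * (b₂ + b₃) := by positivity
    linarith

end NormalizedSummands

end Truncation

theorem theorem3p2 {Ω : Type*} [MeasurableSpace Ω] (P : Measure Ω) [IsProbabilityMeasure P]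
    {n : ℕ} (ξ : Fin n → Ω → ℝ)
    (hmeas : ∀ i, Measurable (ξ i))
    (hindep : iIndepFun ξ P)
    (hL2 : ∀ i, MemLp (ξ i) 2 P)
    (hmean : ∀ i, ∫ ω, ξ i ω ∂P = 0)
    (hvar : ∑ i, variance (ξ i) P = 1)
    (z : ℝ) :
    |P.real {ω | ∑ i, ξ i ω ≤ z} - cdf (gaussianReal 0 1) z|
      ≤ 2 * ∑ i, P.real {ω | max 1 |z| / 4 < |ξ i ω|}
        + constTwo (betaTwo P ξ + betaThree P ξ) z * ((1 + |z|) ^ 2)⁻¹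
          * (betaTwo P ξ + betaThree P ξ) := by
  have h : NormalizedSummands P ξ := ⟨hmeas, hindep, hL2, hmean, hvar⟩
  rw [← gaussLower_eq_cdf]
  rcases le_total 0 z with hz | hz
  · exact h.abs_sub_gaussLower_le (S := Set.Iic z) (Or.inr rfl) hz
  -- Reflection: `W ≤ z` is the complement of `-W < -z`, which is why the half-line result must
  -- cover open rays as well.
  · have hn := h.neg.abs_sub_gaussLower_le (S := Set.Iio (-z)) (z := -z) (Or.inl rfl)
      (neg_nonneg.2 hz)
    have e1 : P.real {ω | psum (fun i ω => -ξ i ω) Finset.univ ω ∈ Set.Iio (-z)}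
        = 1 - P.real {ω | ∑ i, ξ i ω ≤ z} := by
      have hm : MeasurableSet {ω | ∑ i, ξ i ω ≤ z} :=
        measurableSet_le (Finset.measurable_fun_sum _ fun i _ => hmeas i) measurable_const
      rw [← probReal_compl_eq_one_sub hm]
      congr 1
      ext ω
      simp [psum]
    have e2 : gaussLower (-z) = 1 - gaussLower z := by
      have := gaussLower_add_gaussUpper z
      simp only [gaussLower, gaussUpper, neg_neg] at this ⊢
      linarith
    have e3 : largeSecond P (fun i ω => -ξ i ω) = betaTwo P ξ := by
      simp [largeSecond, betaTwo]
    have e4 : smallThird P (fun i ω => -ξ i ω) = betaThree P ξ := by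
      simp [smallThird, betaThree]
    have e5 : constTwo (betaTwo P ξ + betaThree P ξ) (-z)
        = constTwo (betaTwo P ξ + betaThree P ξ) z := by simp [constTwo]
    rw [e1, e2, e3, e4, e5] at hn
    simp only [abs_neg] at hn
    rw [abs_sub_comm]
    convert hn using 2
    ring
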